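/- Let $q\ge 4$ be an integer. For $v=(v_1,\dots,v_q)$ and an invertible $z$, let $L_v(z)$ be the $q\times q$ matrix with diagonal entries $v_1,\dots,v_q$, with entries $1$ in the positions $(i,i+1)$ and $(i+1,i)$ for $1\le i<q$, with entry $z^{-1}$ in position $(1,q)$ and $z$ in position $(q,1)$, and zeros elsewhere. This is the Floquet matrix of $\Delta+V$, where $(\Delta u)(n)=u(n-1)+u(n+1)$ is the discrete Laplacian on $\mathbb{Z}$, $V:\mathbb{Z}\to\mathbb{C}$ is a $q$-periodic potential with $V(i)=v_i$ for $1\le i\le q$, and the Floquet boundary condition is $u(n+q)=z\,u(n)$. Let $D_v(z,\lambda)$ be the characteristic polynomial of $L_v(z)$ in the variable $\lambda$. Treating $v_1,\dots,v_q$ and $z$ as indeterminates, let $E_\Delta\subset\mathbb{C}[v_1,\dots,v_q]$ be the ideal of spectral invariants, generated by the coefficients of all monomials $z^a\lambda^b$ ($a\in\mathbb{Z}$, $b\ge 0$) in $D_v(z,\lambda)-D_0(z,\lambda)$. Two $q$-periodic potentials $V,V'$ are called Floquet isospectral if, for every complex $z$ with $|z|=1$, the Floquet matrices of $\Delta+V$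 and $\Delta+V'$ have the same eigenvalues, counted with algebraic multiplicity. Then the vanishing set of $E_\Delta$ in $\mathbb{C}^q$ contains a nonzero point. Equivalently, there is a nonzero $q$-periodic potential $V:\mathbb{Z}\to\mathbb{C}$ that is Floquet isospectral to the zero potential; indeed, a $q$-periodic potential $V$ is Floquet isospectral to the zero potential if and only if $(V(1),\dots,V(q))$ lies in the vanishing set of $E_\Delta$. -/

import Mathlib

open scoped LaurentPolynomial

noncomputable section

/-- The Floquet matrix `L_v(z)` of `Δ + V` on `ℤ` for a `q`-periodic potential `V` with values
`v = (V 1, …, V q)`: it has `v` on the diagonal, `1` next to the diagonal, and the Floquet boundary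
condition `u (n + q) = z * u n` adds `z⁻¹` in the upper right and `z` in the lower left corner.
(For `q = 2` the corners fall on the off-diagonal and give `1 + z⁻¹` and `1 + z`;
for `q = 1` one gets the entry `v + z + z⁻¹`.) -/
def floquetMatrix {R : Type*} [CommRing R] {q : ℕ} (v : Fin q → R) (z : Rˣ) :
    Matrix (Fin q) (Fin q) R :=
  Matrix.of fun i j =>
    (if i = j then v i else 0)
      + (if (i : ℕ) + 1 = j then 1 else 0)
      + (if (j : ℕ) + 1 = i then 1 else 0)
      + (if (i : ℕ) = 0 ∧ (j : ℕ) + 1 = q then ((z⁻¹ : Rˣ) : R) else 0)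
      + (if (i : ℕ) + 1 = q ∧ (j : ℕ) = 0 then (z : R) else 0)

/-- The values `(V 1, …, V q)` of a potential on a fundamental domain of `qℤ`. -/
def potentialValues (q : ℕ) (V : ℤ → ℂ) : Fin q → ℂ :=
  fun i => V ((i : ℤ) + 1)

/-- The spectrum of `L_V(z)` for `z` on the complex unit circle: the multiset of complex
eigenvalues, counted with algebraic multiplicity. -/
def floquetSpectrum (q : ℕ) (V : ℤ → ℂ) (z : Circle) : Multiset ℂ :=
  (floquetMatrix (potentialValues q V) (Circle.toUnits z)).charpoly.roots

/-- Floquet isospectrality of the `q`-periodic potentials `V` and `W`. -/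
def FloquetIsospectral (q : ℕ) (V W : ℤ → ℂ) : Prop :=
  ∀ z : Circle, floquetSpectrum q V z = floquetSpectrum q W z

/-- The indeterminate `z`, as a unit of the Laurent polynomial ring `R[z, z⁻¹]`. -/
def laurentUnit (R : Type*) [CommRing R] : (R[T;T⁻¹])ˣ where
  val := LaurentPolynomial.T 1
  inv := LaurentPolynomial.T (-1)
  val_inv := by rw [← LaurentPolynomial.T_add]; simp
  inv_val := by rw [← LaurentPolynomial.T_add]; simp

/-- The characteristic polynomial `D_v(z, λ)` of `L_v(z)`, with `z` an indeterminate; it is a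
polynomial in `λ` over the Laurent polynomials in `z`. -/
def dispersionPolynomial {R : Type*} [CommRing R] {q : ℕ} (v : Fin q → R) :
    Polynomial (R[T;T⁻¹]) :=
  (floquetMatrix (fun i => (LaurentPolynomial.C (v i) : R[T;T⁻¹])) (laurentUnit R)).charpoly

/-- The spectral invariant `[z^a λ^b] (D_v(z, λ) - D_0(z, λ))`, where the values `v_1, …, v_q` of
the potential are indeterminates. -/
def spectralInvariant (q : ℕ) (a : ℤ) (b : ℕ) : MvPolynomial (Fin q) ℂ :=
  ((dispersionPolynomial (fun i : Fin q => (MvPolynomial.X i : MvPolynomial (Fin q) ℂ))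
    - dispersionPolynomial (fun _ : Fin q => (0 : MvPolynomial (Fin q) ℂ))).coeff b).coeff a

/-- The ideal of spectral invariants `E_Δ` in `ℂ[v_1, …, v_q]` of the discrete Laplacian on `ℤ`
for the period `q`. -/
def spectralInvariantIdeal (q : ℕ) : Ideal (MvPolynomial (Fin q) ℂ) :=
  Ideal.span {p | ∃ (a : ℤ) (b : ℕ), p = spectralInvariant q a b}

end

/-! By Floquet theory D_v(z, λ) is the discriminant of v, the trace of its transfer matrix over a
period, minus z + z⁻¹ (`charpoly_floquetMatrix`). So v is isospectral to 0 as soon as it has the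
discriminant of 0. Write q = 2m + e with e ≤ 1 and keep only the potentials that are odd under
reflection of the period; they have m free values y_j. Oddness gives the discriminant the parity of
q in λ, so m equations in m unknowns remain. Their leading forms are, up to sign, the elementary
symmetric polynomials in the y_j², and the Bézout number is 2·4⋯2m = 2^m m!.

The origin absorbs fewer solutions than that. At a double eigenvalue z + z⁻¹ of the free problem
(z^(2q) = 1, z² ≠ 1) the discriminant changes only to second order, by a unit times the product of
the Fourier coefficients of v at z² and z⁻². For odd v these two are proportional, so the product is
a unit times the square of one linear form (`sq_mem_of_odd`). Hence the ideal contains, up to cubic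
terms, the squares of m independent linear forms. This bounds the multiplicity at 0 by 2^m, which is
less than 2^m m! for m ≥ 2, so another solution exists.

The comparison is carried out with monomials. If 0 were the only zero, the Nullstellensatz and a
pigeonhole argument (`Ideal.pow_card_succ_le_of_sq_mem`) would put every monomial of degree greater
than m into the ideal. But Newton interpolation at the nodes y_j² (`exists_generators_of_coeff`)
places the invariants in an ideal whose generators have leading monomials y_i^(2(i+1)), and
monomials with all exponents below these stay outside it (`monomial_notMem_span_range`). For m ≥ 2
such a monomial of degree greater than m exists. -/

/-! ### Transfer matrices and the Floquet determinant -/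

/-- The transfer matrix of one site. -/
def transferStep {R : Type*} [CommRing R] (x : R) : Matrix (Fin 2) (Fin 2) R := !![x, -1; 1, 0]

/-- The ordered product of the transfer matrices of the first `n` sites. -/
def transferMatrix {R : Type*} [CommRing R] (x : ℕ → R) (n : ℕ) : Matrix (Fin 2) (Fin 2) R :=
  ((List.range n).map fun i => transferStep (x i)).prod

/-- The Jacobi matrix with diagonal `x` and off-diagonal entries `-1`. -/
def jacobiMatrix {R : Type*} [CommRing R] (x : ℕ → R) (n : ℕ) : Matrix (Fin n) (Fin n) R :=
  Matrix.of fun i j => (if i = j then x i else 0) - (if (i : ℕ) + 1 = j then 1 else 0)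
    - (if (j : ℕ) + 1 = i then 1 else 0)

section
variable {R : Type*} [CommRing R]

theorem transferMatrix_zero (x : ℕ → R) : transferMatrix x 0 = 1 := by simp [transferMatrix]

theorem transferMatrix_succ (x : ℕ → R) (n : ℕ) :
    transferMatrix x (n + 1) = transferMatrix x n * transferStep (x n) := by
  simp [transferMatrix, List.range_succ]

theorem transferMatrix_succ' (x : ℕ → R) (n : ℕ) :
    transferMatrix x (n + 1) = transferStep (x 0) * transferMatrix (fun i => x (i + 1)) n := by
  simp [transferMatrix, List.range_succ_eq_map, Function.comp_def]

theorem det_jacobiMatrix_add_two (x : ℕ → R) (n : ℕ) :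
    (jacobiMatrix x (n + 2)).det = x 0 * (jacobiMatrix (fun i => x (i + 1)) (n + 1)).det
      - (jacobiMatrix (fun i => x (i + 2)) n).det := by
  have h0 : ((jacobiMatrix x (n + 2)).submatrix Fin.succ (Fin.succAbove 0)) =
      jacobiMatrix (fun i => x (i + 1)) (n + 1) := by
    ext i j; simp [jacobiMatrix]
  have h1 : ((jacobiMatrix x (n + 2)).submatrix Fin.succ (Fin.succAbove 1)).det =
      - (jacobiMatrix (fun i => x (i + 2)) n).det := by
    rw [Matrix.det_succ_column_zero, Fin.sum_univ_succ, Finset.sum_eq_zero]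
    · have : ((jacobiMatrix x (n + 2)).submatrix Fin.succ (Fin.succAbove 1)).submatrix
          (Fin.succAbove 0) Fin.succ = jacobiMatrix (fun i => x (i + 2)) n := by
        ext i j
        simp [jacobiMatrix, Fin.succAbove, Fin.lt_def, Fin.ext_iff, add_assoc]
      rw [this]
      simp [jacobiMatrix]
    · intro i _
      simp [jacobiMatrix, Fin.ext_iff]
  rw [Matrix.det_succ_row_zero, Fin.sum_univ_succ, Fin.sum_univ_succ, Finset.sum_eq_zero]
  · simp only [Fin.val_zero, Fin.succ_zero_eq_one, h0, h1]
    simp [jacobiMatrix]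
    ring
  · intro i _
    simp [jacobiMatrix, Fin.ext_iff]

/-- Peeling off the first site gives the first column the same three-term recurrence as expanding
the Jacobi determinant along its first row. -/
theorem transferMatrix_succ_eq (x : ℕ → R) (n : ℕ) :
    transferMatrix x (n + 1) 0 0 = (jacobiMatrix x (n + 1)).det ∧
    transferMatrix x (n + 1) 1 0 = (jacobiMatrix (fun i => x (i + 1)) n).det := by
  induction n generalizing x with
  | zero => simp [transferMatrix, transferStep, jacobiMatrix]
  | succ n ih =>
    rw [transferMatrix_succ', det_jacobiMatrix_add_two]
    obtain ⟨h1, h2⟩ := ih (fun i => x (i + 1))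
    constructor <;> simp [transferStep, Matrix.mul_apply, Fin.sum_univ_two, h1, h2]
    ring_nf

theorem trace_transferMatrix (x : ℕ → R) (n : ℕ) :
    (transferMatrix x (n + 2)).trace = (jacobiMatrix x (n + 2)).det
      - (jacobiMatrix (fun i => x (i + 1)) n).det := by
  rw [Matrix.trace_fin_two, (transferMatrix_succ_eq x (n + 1)).1, transferMatrix_succ]
  simp [transferStep, Matrix.mul_apply, Fin.sum_univ_two, (transferMatrix_succ_eq x n).2]
  ring

/-- Linearity in one row; it allows the two corners to be switched on one after the other. -/
theorem det_updateRow_add_smul_single {n : ℕ} (A : Matrix (Fin (n + 1)) (Fin (n + 1)) R)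
    (i j : Fin (n + 1)) (a : R) :
    (A.updateRow i (A i + a • Pi.single j 1)).det =
      A.det + a * ((-1) ^ (i + j : ℕ) * (A.submatrix i.succAbove j.succAbove).det) := by
  rw [Matrix.det_updateRow_add, Matrix.det_updateRow_smul, Matrix.updateRow_eq_self,
    ← Matrix.adjugate_apply, Matrix.adjugate_fin_succ_eq_det_submatrix]

theorem det_submatrix_succ_castSucc_jacobiMatrix (x : ℕ → R) (n : ℕ) :
    ((jacobiMatrix x (n + 1)).submatrix Fin.succ Fin.castSucc).det = (-1) ^ n := by
  rw [Matrix.det_of_isUpperTriangular]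
  · have h (k : ℕ) : ¬ k + 1 + 1 = k := by omega
    simp [jacobiMatrix, Fin.ext_iff, h]
  · intro i j hij
    have : (j : ℕ) < i := hij
    simp only [jacobiMatrix, Matrix.submatrix_apply, Matrix.of_apply, Fin.ext_iff, Fin.val_succ,
      Fin.val_castSucc]
    rw [if_neg (by omega), if_neg (by omega), if_neg (by omega)]
    simp

theorem det_submatrix_castSucc_succ_jacobiMatrix (x : ℕ → R) (n : ℕ) :
    ((jacobiMatrix x (n + 1)).submatrix Fin.castSucc Fin.succ).det = (-1) ^ n := by
  rw [Matrix.det_of_isLowerTriangular]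
  · have h (k : ℕ) : ¬ k + 1 + 1 = k := by omega
    simp [jacobiMatrix, Fin.ext_iff, h]
  · intro i j hij
    have : (i : ℕ) < j := hij
    simp only [jacobiMatrix, Matrix.submatrix_apply, Matrix.of_apply, Fin.ext_iff, Fin.val_succ,
      Fin.val_castSucc]
    rw [if_neg (by omega), if_neg (by omega), if_neg (by omega)]
    simp

/-- A permutation using both corners swaps the first and last index, which leaves the interior minor
with a minus sign. One using a single corner is a full cycle: its sign (-1)^(n+2) cancels against
the n + 2 remaining entries -1. -/
theorem det_jacobiMatrix_add_corners (x : ℕ → R) (n : ℕ) (a b : R)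
    (N : Matrix (Fin (n + 3)) (Fin (n + 3)) R)
    (hN : ∀ i j, N i j = jacobiMatrix x (n + 3) i j
      + (if (i : ℕ) = 0 ∧ (j : ℕ) + 1 = n + 3 then a else 0)
      + (if (i : ℕ) + 1 = n + 3 ∧ (j : ℕ) = 0 then b else 0)) :
    N.det = (jacobiMatrix x (n + 3)).det - a * b * (jacobiMatrix (fun i => x (i + 1)) (n + 1)).det
      + a + b := by
  set B := jacobiMatrix x (n + 3) with hB
  set A := B.updateRow (Fin.last _) (B (Fin.last _) + b • Pi.single 0 1) with hA
  set B' := B.submatrix Fin.succ Fin.castSucc with hB'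
  have hN' : N = A.updateRow 0 (A 0 + a • Pi.single (Fin.last _) 1) := by
    ext i j
    rw [hN]
    by_cases hi : i = 0
    · have h : (0 : Fin (n + 3)) ≠ Fin.last _ := (Fin.last_pos).ne
      rw [hi, Matrix.updateRow_self, hA, Matrix.updateRow_ne h]
      simp only [Pi.add_apply, Pi.smul_apply, Pi.single_apply, Fin.ext_iff, Fin.val_last,
        Fin.val_zero, smul_eq_mul, mul_ite, mul_one, mul_zero, true_and]
      split_ifs <;> first | omega | (simp; done) | (simp; intro; omega)
    · rw [Matrix.updateRow_ne hi, hA]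
      have hi0 : (i : ℕ) ≠ 0 := fun h => hi (Fin.ext h)
      by_cases hl : i = Fin.last _
      · rw [hl, Matrix.updateRow_self]
        simp only [Pi.add_apply, Pi.smul_apply, Pi.single_apply, Fin.ext_iff, Fin.val_last,
          Fin.val_zero, smul_eq_mul, mul_ite, mul_one, mul_zero, true_and]
        rw [if_neg (by omega), add_zero]
      · rw [Matrix.updateRow_ne hl]
        have hil : (i : ℕ) ≠ n + 2 := fun h => hl (Fin.ext h)
        rw [if_neg (by omega), if_neg (by omega), add_zero, add_zero]
  have hA' : A.submatrix Fin.succ Fin.castSucc =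
      B'.updateRow (Fin.last _) (B' (Fin.last _) + b • Pi.single 0 1) := by
    ext i j
    rw [Matrix.submatrix_apply, hA]
    by_cases hl : i = Fin.last _
    · rw [hl, Matrix.updateRow_self, Fin.succ_last, Matrix.updateRow_self]
      simp only [Pi.add_apply, Pi.smul_apply, Pi.single_apply, Fin.ext_iff, Fin.val_castSucc,
          Fin.val_zero, hB', Matrix.submatrix_apply, Fin.succ_last]
    · have hl' : i.succ ≠ Fin.last _ := fun h => hl (Fin.succ_injective _ (by rw [h, Fin.succ_last]))
      rw [Matrix.updateRow_ne hl, Matrix.updateRow_ne hl', hB', Matrix.submatrix_apply]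
  have hB'' : B'.submatrix Fin.castSucc Fin.succ = jacobiMatrix (fun i => x (i + 1)) (n + 1) := by
    ext i j
    simp only [hB', hB, jacobiMatrix, Matrix.submatrix_apply, Matrix.of_apply, Fin.ext_iff,
      Fin.val_succ, Fin.val_castSucc, Nat.add_right_cancel_iff]
  rw [hN', det_updateRow_add_smul_single, hA, det_updateRow_add_smul_single, ← hA]
  simp only [Fin.succAbove_zero, Fin.succAbove_last]
  rw [hA', det_updateRow_add_smul_single]
  simp only [Fin.succAbove_zero, Fin.succAbove_last, hB'']
  rw [hB', hB, det_submatrix_succ_castSucc_jacobiMatrix, det_submatrix_castSucc_succ_jacobiMatrix]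
  simp only [Fin.val_zero, Fin.val_last, zero_add, add_zero]
  have h1 : ((-1 : R) ^ (n + 2)) * (-1) ^ (n + 2) = 1 := by rw [← mul_pow]; simp
  have h2 : ((-1 : R) ^ (n + 2)) * (-1) ^ (n + 1) = -1 := by
    rw [pow_succ (-1 : R) (n + 1), mul_right_comm, ← mul_pow]; simp
  linear_combination (b + a) * h1 + a * b * (jacobiMatrix (fun i => x (i + 1)) (n + 1)).det * h2

/-- Floquet theory: `D_v(z, λ)` is the trace of the transfer matrix minus `z + z⁻¹`. -/
theorem charpoly_floquetMatrix {q : ℕ} (hq : 3 ≤ q) (v : ℕ → R) (z : Rˣ) :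
    (floquetMatrix (fun i : Fin q => v i) z).charpoly =
      (transferMatrix (fun i => Polynomial.X - Polynomial.C (v i)) q).trace
        - Polynomial.C ((z⁻¹ : Rˣ) : R) - Polynomial.C (z : R) := by
  obtain ⟨n, rfl⟩ := Nat.exists_eq_add_of_le' hq
  rw [Matrix.charpoly, det_jacobiMatrix_add_corners (fun i => Polynomial.X - Polynomial.C (v i)) n
    (-Polynomial.C ((z⁻¹ : Rˣ) : R)) (-Polynomial.C (z : R)), trace_transferMatrix _ (n + 1)]
  -- The corners multiply to 1, so the interior minor appears exactly as in the trace formula.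
  · rw [neg_mul_neg, ← Polynomial.C_mul, Units.inv_mul, Polynomial.C_1]
    ring
  · intro i j
    simp only [Matrix.charmatrix_apply, floquetMatrix, jacobiMatrix, Matrix.diagonal_apply,
      Matrix.of_apply, Polynomial.C_add, apply_ite Polynomial.C, Polynomial.C_0, Polynomial.C_1]
    split_ifs <;> ring

end

/-! ### Specialisation, spectral invariants and isospectrality -/

section
variable {R S : Type*} [CommRing R] [CommRing S]

theorem transferMatrix_map (f : R →+* S) (x : ℕ → R) (n : ℕ) :
    (transferMatrix x n).map f = transferMatrix (fun i => f (x i)) n := by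
  induction n with
  | zero => simp [transferMatrix_zero]
  | succ n ih =>
    rw [transferMatrix_succ, transferMatrix_succ, Matrix.map_mul, ih]
    congr 1
    ext i j
    fin_cases i <;> fin_cases j <;> simp [transferStep]

theorem map_floquetMatrix (f : R →+* S) {q : ℕ} (v : Fin q → R) (z : Rˣ) :
    (floquetMatrix v z).map f = floquetMatrix (fun i => f (v i)) (Units.map f z) := by
  ext i j
  simp only [floquetMatrix, Matrix.map_apply, Matrix.of_apply, map_add, apply_ite f, map_zero,
    map_one, Units.coe_map, MonoidHom.coe_coe, ← map_inv]

/-- Serves two substitutions: numbers for the indeterminate potential with z kept formal, and a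
point of the circle for z. -/
theorem map_eval₂_dispersionPolynomial (f : R →+* S) (z : Sˣ) {q : ℕ} (v : Fin q → R) :
    (dispersionPolynomial v).map (LaurentPolynomial.eval₂ f z) =
      (floquetMatrix (fun i => f (v i)) z).charpoly := by
  rw [dispersionPolynomial, ← Matrix.charpoly_map]
  congr 1
  have hz : Units.map (LaurentPolynomial.eval₂ f z).toMonoidHom (laurentUnit R) = z := by
    ext
    simp [laurentUnit]
  rw [map_floquetMatrix]
  simp only [LaurentPolynomial.eval₂_C]
  congr 1

theorem coeff_eval₂_laurentUnit (f : R →+* S) (p : R[T;T⁻¹]) (a : ℤ) :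
    (LaurentPolynomial.eval₂ ((LaurentPolynomial.C).comp f) (laurentUnit S) p).coeff a =
      f (p.coeff a) := by
  have hT (n : ℤ) : (((laurentUnit S) ^ n : (S[T;T⁻¹])ˣ) : S[T;T⁻¹]) = LaurentPolynomial.T n := by
    induction n using Int.induction_on with
    | zero => simp
    | succ n ih => rw [zpow_add_one, Units.val_mul, ih, LaurentPolynomial.T_add]; rfl
    | pred n ih => rw [zpow_sub_one, Units.val_mul, ih, LaurentPolynomial.T_sub]; rfl
  induction p using LaurentPolynomial.induction_on' with
  | add p q hp hq => simp [hp, hq]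
  | C_mul_T n r =>
    rw [LaurentPolynomial.eval₂_C_mul_T, hT, RingHom.comp_apply,
      ← LaurentPolynomial.single_eq_C_mul_T, ← LaurentPolynomial.single_eq_C_mul_T,
      AddMonoidAlgebra.coeff_single, AddMonoidAlgebra.coeff_single, Finsupp.single_apply,
      Finsupp.single_apply, apply_ite f, map_zero]

end

/-- Forming D commutes with specialising the potential, so the generators take at v the values of
the coefficients of D_v - D_0. -/
theorem mem_zeroLocus_spectralInvariantIdeal {q : ℕ} (v : Fin q → ℂ) :
    v ∈ MvPolynomial.zeroLocus ℂ (spectralInvariantIdeal q) ↔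
      dispersionPolynomial v = dispersionPolynomial (0 : Fin q → ℂ) := by
  have key (w : Fin q → MvPolynomial (Fin q) ℂ) (a : ℤ) (b : ℕ) :
      MvPolynomial.aeval v (((dispersionPolynomial w).coeff b).coeff a) =
        ((dispersionPolynomial fun i => MvPolynomial.aeval v (w i)).coeff b).coeff a := by
    have h := map_eval₂_dispersionPolynomial
      ((LaurentPolynomial.C).comp (MvPolynomial.aeval v : _ →ₐ[ℂ] ℂ).toRingHom) (laurentUnit ℂ) w
    have h' := congrArg (fun p => (p.coeff b).coeff a) h
    simp only [Polynomial.coeff_map, coeff_eval₂_laurentUnit] at h'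
    exact h'
  have hinv (a : ℤ) (b : ℕ) : MvPolynomial.aeval v (spectralInvariant q a b) =
      ((dispersionPolynomial v).coeff b).coeff a -
        ((dispersionPolynomial (0 : Fin q → ℂ)).coeff b).coeff a := by
    rw [spectralInvariant, Polynomial.coeff_sub, AddMonoidAlgebra.coeff_sub, Finsupp.sub_apply,
      map_sub, key, key]
    simp only [MvPolynomial.aeval_X, map_zero]
    rfl
  rw [spectralInvariantIdeal, MvPolynomial.zeroLocus_span]
  constructor
  · intro h
    ext b a
    have := h _ ⟨a, b, rfl⟩
    rw [hinv] at this
    exact sub_eq_zero.1 this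
  · rintro h _ ⟨a, b, rfl⟩
    rw [hinv, h, sub_self]

theorem Circle.infinite : Infinite Circle := by
  have h1 (n : ℕ) : 1 / ((n : ℝ) + 1) ≤ 1 := by
    rw [div_le_one (by positivity)]
    simp
  have h2 (n : ℕ) : Complex.arg (Circle.exp (1 / ((n : ℝ) + 1))) = 1 / ((n : ℝ) + 1) :=
    Circle.arg_exp ((neg_lt_zero.2 Real.pi_pos).trans (by positivity))
      ((h1 n).trans (by linarith [Real.pi_gt_three]))
  refine Infinite.of_injective (fun n : ℕ => Circle.exp (1 / ((n : ℝ) + 1))) fun a b hab => ?_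
  have := (h2 a).symm.trans ((congrArg (fun z : Circle => Complex.arg z) hab).trans (h2 b))
  simpa using this

/-- Multiplying by a power of T leaves an ordinary polynomial with infinitely many roots. -/
theorem LaurentPolynomial.eq_zero_of_eval₂_circle (p : ℂ[T;T⁻¹])
    (h : ∀ z : Circle, LaurentPolynomial.eval₂ (RingHom.id ℂ) (Circle.toUnits z) p = 0) : p = 0 := by
  have := Circle.infinite
  obtain ⟨n, p', hp⟩ := LaurentPolynomial.exists_T_pow p
  have h0 : p' = 0 := by
    refine Polynomial.eq_zero_of_infinite_isRoot p' (Set.Infinite.mono ?_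
      (Set.infinite_range_of_injective (f := fun z : Circle => (z : ℂ)) Circle.coe_injective))
    rintro _ ⟨z, rfl⟩
    have := congrArg (LaurentPolynomial.eval₂ (RingHom.id ℂ) (Circle.toUnits z)) hp
    rw [map_mul, h, zero_mul, LaurentPolynomial.eval₂_toLaurent] at this
    exact this
  rw [h0, map_zero] at hp
  have := congrArg (· * LaurentPolynomial.T (-n)) hp
  rw [zero_mul, mul_assoc, ← LaurentPolynomial.T_add, add_neg_cancel, LaurentPolynomial.T_zero,
    mul_one] at this
  exact this.symm

/-- Over ℂ a monic polynomial is determined by its roots with multiplicity, and a Laurent polynomial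
in z by its values on the circle. -/
theorem floquetIsospectral_iff {q : ℕ} (V W : ℤ → ℂ) :
    FloquetIsospectral q V W ↔
      dispersionPolynomial (potentialValues q V) = dispersionPolynomial (potentialValues q W) := by
  have hmap (V : ℤ → ℂ) (z : Circle) := map_eval₂_dispersionPolynomial (RingHom.id ℂ)
    (Circle.toUnits z) (potentialValues q V)
  simp only [RingHom.id_apply] at hmap
  constructor
  · intro h
    ext1 b
    rw [← sub_eq_zero]
    refine LaurentPolynomial.eq_zero_of_eval₂_circle _ fun z => ?_
    have hz : (floquetMatrix (potentialValues q V) (Circle.toUnits z)).charpoly =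
        (floquetMatrix (potentialValues q W) (Circle.toUnits z)).charpoly := by
      have h1 := (IsAlgClosed.splits (floquetMatrix (potentialValues q V)
        (Circle.toUnits z)).charpoly).eq_prod_roots_of_monic (Matrix.charpoly_monic _)
      have h2 := (IsAlgClosed.splits (floquetMatrix (potentialValues q W)
        (Circle.toUnits z)).charpoly).eq_prod_roots_of_monic (Matrix.charpoly_monic _)
      rw [h1, h2]
      have := h z
      rw [floquetSpectrum, floquetSpectrum] at this
      rw [this]
    rw [← hmap, ← hmap] at hz
    rw [map_sub, ← Polynomial.coeff_map, ← Polynomial.coeff_map, hz, sub_self]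
  · intro h z
    rw [floquetSpectrum, floquetSpectrum, ← hmap, ← hmap, h]

/-- Potentials with the same discriminant have the same characteristic polynomial `D(z, λ)`. -/
theorem dispersionPolynomial_eq_of_trace_eq {R : Type*} [CommRing R] {q : ℕ} (hq : 3 ≤ q)
    (v w : ℕ → R)
    (h : (transferMatrix (fun i => Polynomial.X - Polynomial.C (v i)) q).trace =
      (transferMatrix (fun i => Polynomial.X - Polynomial.C (w i)) q).trace) :
    dispersionPolynomial (fun i : Fin q => v i) = dispersionPolynomial (fun i : Fin q => w i) := by
  have hmap (v : ℕ → R) : (transferMatrix (fun i => Polynomial.X -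
      Polynomial.C (LaurentPolynomial.C (v i))) q).trace =
      (transferMatrix (fun i => Polynomial.X - Polynomial.C (v i)) q).trace.map
        LaurentPolynomial.C := by
    have h1 := transferMatrix_map (Polynomial.mapRingHom (LaurentPolynomial.C (R := R)))
      (fun i => Polynomial.X - Polynomial.C (v i)) q
    simp only [map_sub, Polynomial.coe_mapRingHom, Polynomial.map_X, Polynomial.map_C] at h1
    rw [← h1]
    simp [Matrix.trace_fin_two]
  rw [dispersionPolynomial, dispersionPolynomial,
    charpoly_floquetMatrix hq (fun i => LaurentPolynomial.C (v i)),
    charpoly_floquetMatrix hq (fun i => LaurentPolynomial.C (w i)), hmap, hmap, h]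

/-! ### Ideals whose generators have pure powers as leading monomials -/

section
open MvPolynomial MonomialOrder
open scoped MonomialOrder

variable {σ k : Type*} [Fintype σ] [Field k]

/-- If the leading exponents of `g` are the pure powers `d i • single i 1`, then the products
`∏ X i ^ (n i % d i) * g i ^ (n i / d i)` have leading exponent `n`. -/
noncomputable def mixedPower (g : σ → MvPolynomial σ k) (d : σ → ℕ) (n : σ →₀ ℕ) : MvPolynomial σ k :=
  ∏ i, X i ^ (n i % d i) * g i ^ (n i / d i)

variable (m : MonomialOrder σ) {g : σ → MvPolynomial σ k} {d : σ → ℕ}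

theorem mixedPower_ne_zero (hg0 : ∀ i, g i ≠ 0) (n : σ →₀ ℕ) : mixedPower g d n ≠ 0 :=
  Finset.prod_ne_zero_iff.2 fun i _ => mul_ne_zero (pow_ne_zero _ (X_ne_zero i))
    (pow_ne_zero _ (hg0 i))

theorem degree_mixedPower (hg0 : ∀ i, g i ≠ 0) (hg : ∀ i, m.degree (g i) = Finsupp.single i (d i))
    (n : σ →₀ ℕ) : m.degree (mixedPower g d n) = n := by
  classical
  rw [mixedPower, degree_prod]
  · have h (i : σ) : m.degree (X i ^ (n i % d i) * g i ^ (n i / d i)) =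
        Finsupp.single i (n i) := by
      rw [degree_mul (pow_ne_zero _ (X_ne_zero i)) (pow_ne_zero _ (hg0 i)), degree_pow,
        degree_pow, hg, degree_X, Finsupp.smul_single, Finsupp.smul_single, ← Finsupp.single_add]
      congr 1
      simp [mul_comm (n i / d i), Nat.mod_add_div]
    simp_rw [h]
    exact Finsupp.univ_sum_single n
  · exact fun i _ => mul_ne_zero (pow_ne_zero _ (X_ne_zero i)) (pow_ne_zero _ (hg0 i))

/-- There is one product for each leading exponent, so the leading term of p can be cancelled; the
monomial order is a well-order and the process stops. -/
theorem mem_span_mixedPower (hg0 : ∀ i, g i ≠ 0)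
    (hg : ∀ i, m.degree (g i) = Finsupp.single i (d i)) (p : MvPolynomial σ k) :
    p ∈ Submodule.span k (Set.range (mixedPower g d)) := by
  induction h : m.toSyn (m.degree p) using WellFoundedLT.induction generalizing p with
  | ind s ih =>
    subst h
    set B := mixedPower g d (m.degree p) with hB
    have hBdeg : m.degree B = m.degree p := degree_mixedPower m hg0 hg _
    have hlc : m.leadingCoeff B ≠ 0 := m.leadingCoeff_ne_zero_iff.2 (mixedPower_ne_zero hg0 _)
    set r := p - (m.leadingCoeff p / m.leadingCoeff B) • B with hr
    have hBmem : (m.leadingCoeff p / m.leadingCoeff B) • B ∈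
        Submodule.span k (Set.range (mixedPower g d)) :=
      Submodule.smul_mem _ _ (Submodule.subset_span ⟨_, rfl⟩)
    suffices r ∈ Submodule.span k (Set.range (mixedPower g d)) by
      simpa [hr] using Submodule.add_mem _ this hBmem
    by_cases hr0 : r = 0
    · rw [hr0]; exact Submodule.zero_mem _
    refine ih _ ?_ r rfl
    have hne : r.coeff (m.degree r) ≠ 0 := m.coeff_degree_ne_zero_iff.2 hr0
    by_contra hlt
    rcases eq_or_lt_of_le (not_lt.1 hlt) with heq | hgt
    · have heq' : m.degree r = m.degree p := m.toSyn.injective heq.symm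
      apply hne
      rw [heq', hr, coeff_sub, coeff_smul, ← hBdeg, smul_eq_mul]
      change p.coeff (m.degree B) - m.leadingCoeff p / m.leadingCoeff B * m.leadingCoeff B = 0
      rw [div_mul_cancel₀ _ hlc, hBdeg]
      exact sub_self _
    · apply hne
      rw [hr, coeff_sub, coeff_smul, m.coeff_eq_zero_of_lt hgt,
        m.coeff_eq_zero_of_lt (by rwa [hBdeg])]
      simp

/-- If the leading exponents of `g` are pure powers `d i • single i 1`, then no monomial with all
exponents below `d` lies in the ideal generated by `g`. -/
theorem monomial_notMem_span_range (hd : ∀ i, 0 < d i)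
    (hg : ∀ i, m.degree (g i) = Finsupp.single i (d i)) {a : σ →₀ ℕ} (ha : ∀ i, a i < d i) :
    monomial a (1 : k) ∉ Ideal.span (Set.range g) := by
  classical
  have hg0 (i : σ) : g i ≠ 0 := m.ne_zero_of_degree_ne_zero (by simp [hg, (hd i).ne'])
  intro hmem
  -- The products containing some `g i` span a space that contains the ideal: multiplying by `g i`
  -- raises `n i` by `d i` and keeps its residue.
  set Z := Submodule.span k (mixedPower g d '' {n | ∃ i, d i ≤ n i}) with hZ
  have hgZ (c : MvPolynomial σ k) (i : σ) : c * g i ∈ Z := by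
    induction mem_span_mixedPower m hg0 hg c using Submodule.span_induction with
    | zero => simp
    | add x y _ _ hx hy => rw [add_mul]; exact Z.add_mem hx hy
    | smul r x _ hx => rw [smul_mul_assoc]; exact Z.smul_mem _ hx
    | mem x hx =>
      obtain ⟨n, rfl⟩ := hx
      refine Submodule.subset_span ⟨n + Finsupp.single i (d i), ⟨i, by simp⟩, ?_⟩
      rw [mixedPower, mixedPower, ← Finset.mul_prod_erase _ _ (Finset.mem_univ i),
        ← Finset.mul_prod_erase Finset.univ (fun j => X j ^ (n j % d j) * g j ^ (n j / d j))
          (Finset.mem_univ i)]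
      have h1 : ∏ j ∈ Finset.univ.erase i, (X j ^ ((n + Finsupp.single i (d i)) j % d j) *
          g j ^ ((n + Finsupp.single i (d i)) j / d j)) =
          ∏ j ∈ Finset.univ.erase i, (X j ^ (n j % d j) * g j ^ (n j / d j)) := by
        refine Finset.prod_congr rfl fun j hj => ?_
        rw [Finsupp.add_apply, Finsupp.single_eq_of_ne (Finset.ne_of_mem_erase hj), add_zero]
      rw [h1, Finsupp.add_apply, Finsupp.single_eq_same, Nat.add_mod_right,
        Nat.add_div_right _ (hd i), pow_succ]
      ring
  have hmemZ : monomial a (1 : k) ∈ Z := by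
    obtain ⟨c, hc⟩ := Ideal.mem_span_range_iff_exists_fun.1 hmem
    rw [← hc]
    exact Submodule.sum_mem _ fun i _ => hgZ _ _
  obtain ⟨l, hl, hla⟩ := (Finsupp.mem_span_image_iff_linearCombination k).1 hmemZ
  have hl0 : l.support.Nonempty := by
    rw [Finsupp.support_nonempty_iff]
    rintro rfl
    rw [map_zero] at hla
    exact one_ne_zero (monomial_eq_zero.1 hla.symm)
  -- Leading exponents are distinct, so the largest one cannot cancel. It must then equal `a`,
  -- although one of its coordinates is at least `d i`.
  obtain ⟨n, hn, hmax⟩ := Finset.exists_max_image l.support m.toSyn hl0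
  have hcoeff : coeff n (monomial a (1 : k)) = l n * coeff n (mixedPower g d n) := by
    rw [← hla, Finsupp.linearCombination_apply, Finsupp.sum, coeff_sum, Finset.sum_eq_single n]
    · simp
    · intro b hb hbn
      have hlt : m.toSyn b < m.toSyn n :=
        lt_of_le_of_ne (hmax b hb) fun h => hbn (m.toSyn.injective h)
      rw [coeff_smul, m.coeff_eq_zero_of_lt (by rwa [degree_mixedPower m hg0 hg]), smul_zero]
    · exact fun h => absurd hn h
  have hne : l n * coeff n (mixedPower g d n) ≠ 0 := by
    refine mul_ne_zero (Finsupp.mem_support_iff.1 hn) ?_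
    have := m.coeff_degree_ne_zero_iff.2 (mixedPower_ne_zero (d := d) hg0 n)
    rwa [degree_mixedPower m hg0 hg] at this
  rw [← hcoeff, coeff_monomial] at hne
  have han : a = n := by
    by_contra h
    simp [h] at hne
  obtain ⟨i, hi⟩ := (Finsupp.mem_supported k l).1 hl hn
  exact absurd (ha i) (by rw [han]; exact not_lt.2 hi)

end

/-! ### Multiplicity at the origin against the Bézout number -/

section
open MvPolynomial MonomialOrder
open scoped MonomialOrder

/-- If the squares of generators `w` of an ideal `J` lie in `I` up to third order terms, and `I`
contains a power of `J`, then `I` contains the power of `J` after the number of generators. -/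
theorem Ideal.pow_card_succ_le_of_sq_mem {A ι : Type*} [CommRing A] [Fintype ι] {I J : Ideal A}
    {w : ι → A} (hw : Ideal.span (Set.range w) = J) (hI : ∀ i, w i ^ 2 ∈ I ⊔ J ^ 3)
    (hJ : ∃ N, J ^ N ≤ I) : J ^ (Fintype.card ι + 1) ≤ I := by
  classical
  have hwJ (i : ι) : w i ∈ J := hw ▸ Ideal.subset_span ⟨i, rfl⟩
  -- A product of more generators than there are indices repeats one of them, and its square moves
  -- the product into I or one order deeper.
  have step (d : ℕ) (hd : Fintype.card ι < d) : J ^ d ≤ I ⊔ J ^ (d + 1) := by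
    conv_lhs => rw [← hw, Ideal.span, Submodule.span_pow]
    refine Submodule.span_le.2 fun x hx => ?_
    obtain ⟨f, rfl⟩ := Set.mem_pow.1 hx
    choose c hc using fun i => (f i).2
    obtain ⟨i, j, hij, hcij⟩ := Fintype.exists_ne_map_eq_of_card_lt c (by simpa using hd)
    have hprod : (List.ofFn fun i => (f i : A)).prod =
        w (c i) ^ 2 * ∏ l ∈ (Finset.univ.erase i).erase j, w (c l) := by
      simp_rw [← hc]
      rw [List.prod_ofFn, ← Finset.mul_prod_erase _ _ (Finset.mem_univ i),
        ← Finset.mul_prod_erase (Finset.univ.erase i) _ (Finset.mem_erase.2 ⟨hij.symm,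
          Finset.mem_univ j⟩), hcij]
      ring
    have hrest : ∏ l ∈ (Finset.univ.erase i).erase j, w (c l) ∈ J ^ (d - 2) := by
      have := Ideal.prod_mem_prod (s := (Finset.univ.erase i).erase j) (I := fun _ => J)
        (x := fun l => w (c l)) fun l _ => hwJ (c l)
      rwa [Finset.prod_const, Finset.card_erase_of_mem (Finset.mem_erase.2 ⟨hij.symm,
          Finset.mem_univ j⟩), Finset.card_erase_of_mem (Finset.mem_univ i), Finset.card_univ,
          Fintype.card_fin, Nat.sub_sub] at this
    have h2 : 2 ≤ d := by
      have := i.2; have := j.2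
      have : (i : ℕ) ≠ j := fun h => hij (Fin.ext h)
      omega
    have hmul := Ideal.mul_mem_mul (hI (c i)) hrest
    rw [Ideal.sup_mul, ← pow_add, show 3 + (d - 2) = d + 1 by omega] at hmul
    rw [hprod]
    exact (sup_le_sup_right (c := J ^ (d + 1)) (Ideal.mul_le_left (I := I) (J := J ^ (d - 2)))) hmul
  have iter (j : ℕ) : J ^ (Fintype.card ι + 1) ≤ I ⊔ J ^ (Fintype.card ι + 1 + j) := by
    induction j with
    | zero => exact le_sup_right
    | succ j ih =>
      exact ih.trans (sup_le le_sup_left (step _ (by omega)))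
  obtain ⟨N, hN⟩ := hJ
  refine (iter N).trans (sup_le le_rfl ((Ideal.pow_le_pow_right ?_).trans hN))
  omega

/-- By the Nullstellensatz every variable lies in the radical, and finitely many variables have a
common power. -/
theorem exists_idealOfVars_pow_le_of_zeroLocus_subset {σ k : Type*} [Finite σ] [Field k]
    [IsAlgClosed k] {I : Ideal (MvPolynomial σ k)} (hI : zeroLocus k I ⊆ {0}) :
    ∃ N, idealOfVars σ k ^ N ≤ I := by
  refine Ideal.exists_pow_le_of_le_radical_of_fg ?_ (idealOfVars_fg σ k)
  rw [← vanishingIdeal_zeroLocus_eq_radical (K := k), Ideal.span_le]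
  rintro _ ⟨i, rfl⟩
  rw [SetLike.mem_coe, mem_vanishingIdeal_iff]
  intro x hx
  rw [hI hx]
  simp

/-- Comparison of the multiplicity at the origin with the Bézout number: if `n ≥ 2` polynomials in
`n` variables have leading exponents `2 (i + 1) • single i 1` and their ideal contains the squares
of a basis of the linear forms up to third order terms, then they have a common zero besides the
origin. -/
theorem exists_ne_zero_mem_zeroLocus {n : ℕ} (hn : 2 ≤ n) {k : Type*} [Field k] [IsAlgClosed k]
    (m : MonomialOrder (Fin n)) {g w : Fin n → MvPolynomial (Fin n) k}
    (hg : ∀ i, m.degree (g i) = Finsupp.single i (2 * ((i : ℕ) + 1)))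
    (hw : Ideal.span (Set.range w) = idealOfVars (Fin n) k)
    (hwg : ∀ i, w i ^ 2 ∈ Ideal.span (Set.range g) ⊔ idealOfVars (Fin n) k ^ 3) :
    ∃ x : Fin n → k, x ≠ 0 ∧ x ∈ zeroLocus k (Ideal.span (Set.range g)) := by
  by_contra! hcon
  have hle := Ideal.pow_card_succ_le_of_sq_mem hw hwg
    (exists_idealOfVars_pow_le_of_zeroLocus_subset fun x hx => by
      by_contra hx0
      exact hcon x hx0 hx)
  rw [Fintype.card_fin] at hle
  let i₁ : Fin n := ⟨1, hn⟩
  -- The product of all variables times X₁² has degree n + 2 > n, yet its exponents 1, 3, 1, … stay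
  -- below 2, 4, 6, …. A second variable is needed here.
  set a : Fin n →₀ ℕ := Finsupp.equivFunOnFinite.symm (fun _ => 1) + Finsupp.single i₁ 2 with ha
  refine monomial_notMem_span_range m (d := fun i => 2 * ((i : ℕ) + 1)) (fun i => by positivity) hg
    (a := a) (fun i => ?_) (hle ((monomial_mem_pow_idealOfVars_iff _ _ one_ne_zero).2 ?_))
  · rcases eq_or_ne i i₁ with rfl | hi
    · simp [ha, i₁]
    · simp [ha, Finsupp.single_eq_of_ne hi]
      omega
  · rw [ha, map_add, Finsupp.degree_single, Finsupp.degree_eq_sum]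
    simp

end

/-! ### Leading monomials by Newton interpolation -/

section
open MvPolynomial MonomialOrder
open scoped MonomialOrder

variable {n : ℕ} {k : Type*} [Field k]

variable (n k) in
/-- The polynomials of total degree at most `d` whose top degree part does not involve the
variables before the `l`-th. -/
noncomputable def topPartFrom (l d : ℕ) : Submodule k (MvPolynomial (Fin n) k) :=
  restrictSupport k {s | s.degree ≤ d ∧ (s.degree = d → ∀ i : Fin n, (i : ℕ) < l → s i = 0)}

theorem mem_topPartFrom {l d : ℕ} {p : MvPolynomial (Fin n) k} :
    p ∈ topPartFrom n k l d ↔ ∀ s ∈ p.support, s.degree ≤ d ∧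
      (s.degree = d → ∀ i : Fin n, (i : ℕ) < l → s i = 0) := Iff.rfl

theorem topPartFrom_anti {l l' d : ℕ} (h : l ≤ l') : topPartFrom n k l' d ≤ topPartFrom n k l d :=
  fun _ hp _ hs => ⟨(hp hs).1, fun hd i hi => (hp hs).2 hd i (hi.trans_le h)⟩

theorem mul_mem_topPartFrom {l d d' : ℕ} {p p' : MvPolynomial (Fin n) k}
    (hp : p ∈ topPartFrom n k l d) (hp' : p' ∈ topPartFrom n k l d') :
    p * p' ∈ topPartFrom n k l (d + d') := by
  classical
  rw [mem_topPartFrom] at *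
  intro s hs
  obtain ⟨t, ht, t', ht', rfl⟩ := Finset.mem_add.1 (support_mul p p' hs)
  obtain ⟨h1, h2⟩ := hp t ht
  obtain ⟨h1', h2'⟩ := hp' t' ht'
  rw [map_add]
  refine ⟨add_le_add h1 h1', fun h i hi => ?_⟩
  rw [Finsupp.add_apply, h2 (by omega) i hi, h2' (by omega) i hi]

theorem one_mem_topPartFrom (l : ℕ) : (1 : MvPolynomial (Fin n) k) ∈ topPartFrom n k l 0 := by
  rw [mem_topPartFrom]
  intro s hs
  have : s = 0 := by simpa using hs
  simp [this]

theorem pow_mem_topPartFrom {l d : ℕ} {p : MvPolynomial (Fin n) k} (hp : p ∈ topPartFrom n k l d)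
    (j : ℕ) : p ^ j ∈ topPartFrom n k l (j * d) := by
  induction j with
  | zero => simpa using one_mem_topPartFrom l
  | succ j ih =>
    rw [pow_succ, add_mul, one_mul]
    exact mul_mem_topPartFrom ih hp

theorem X_mem_topPartFrom (i : Fin n) : (X i : MvPolynomial (Fin n) k) ∈ topPartFrom n k i 1 := by
  rw [mem_topPartFrom]
  intro s hs
  have : s = Finsupp.single i 1 := by simpa [support_X] using hs
  subst this
  refine ⟨by simp, fun _ j hj => Finsupp.single_eq_of_ne ?_⟩
  rintro rfl
  exact hj.false

/-- `degLex` compares total degree first and then treats earlier variables as larger. Among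
monomials of degree d free of the variables before X i, the pure power of X i therefore dominates.
-/
theorem degree_degLex_eq_single {i : Fin n} {d : ℕ} {c : k} (hc : c ≠ 0)
    {r : MvPolynomial (Fin n) k}
    (hr : ∀ s ∈ r.support, s.degree ≤ d ∧
      (s.degree = d → (∀ j < i, s j = 0) ∧ s i < d)) :
    degLex.degree (monomial (Finsupp.single i d) c + r) = Finsupp.single i d := by
  classical
  have hnot : r.coeff (Finsupp.single i d) = 0 := by
    by_contra h
    have := ((hr _ (mem_support_iff.2 h)).2 (by simp)).2
    simp at this
  apply degLex.toSyn.injective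
  apply le_antisymm
  · rw [degree_le_iff]
    intro s hs
    rcases Finset.mem_union.1 (support_add hs) with h | h
    · have : s = Finsupp.single i d := by simpa [hc, eq_comm] using h
      rw [this]
    · obtain ⟨h1, h2⟩ := hr s h
      rw [degLex_le_iff, Finsupp.DegLex.le_iff]
      simp only [ofDegLex_toDegLex, Finsupp.degree_single]
      rcases h1.lt_or_eq with h1 | h1
      · exact Or.inl h1
      · obtain ⟨h3, h4⟩ := h2 h1
        refine Or.inr ⟨h1, le_of_lt (Finsupp.Lex.lt_iff.2 ⟨i, fun j hj => ?_, ?_⟩)⟩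
        · simpa [Finsupp.single_eq_of_ne hj.ne] using h3 j hj
        · simpa using h4
  · apply le_degree
    rw [mem_support_iff, coeff_add, hnot, coeff_monomial]
    simpa using hc

/-- Newton interpolation at the nodes `X i ^ 2`: the coefficients of a polynomial of the form
`∏ (t - X i ^ 2) - t ^ l + …` lie in an ideal whose generators have pure powers as leading
monomials. -/
theorem exists_generators_of_coeff (l : ℕ) (hl : l ≤ n) (G : Polynomial (MvPolynomial (Fin n) k))
    (hdeg : G.natDegree ≤ l) (htop : G.coeff l = -1)
    (hG : ∀ b ≤ l, G.coeff b ∈ topPartFrom n k l (2 * (l - b))) :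
    ∃ g : Fin n → MvPolynomial (Fin n) k,
      (∀ i : Fin n, (i : ℕ) < l → degLex.degree (g i) = Finsupp.single i (2 * ((i : ℕ) + 1))) ∧
      ∀ b, (∏ i : Fin n with i.val < l, (Polynomial.X - Polynomial.C (X i ^ 2)) + G).coeff b ∈
        Ideal.span (g '' {i | (i : ℕ) < l}) := by
  classical
  induction l generalizing G with
  | zero =>
    refine ⟨0, by simp, fun b => ?_⟩
    rw [Polynomial.eq_C_of_natDegree_le_zero hdeg, htop]
    simp
  | succ l ih =>
    let i₀ : Fin n := ⟨l, hl⟩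
    set u : MvPolynomial (Fin n) k := X i₀ ^ 2 with hu
    have hu_mem (j : ℕ) : u ^ j ∈ topPartFrom n k l (2 * j) := by
      have := pow_mem_topPartFrom (pow_mem_topPartFrom (X_mem_topPartFrom (k := k) i₀) 2) j
      rwa [show j * (2 * 1) = 2 * j by ring] at this
    -- The divided difference of G at the node u. It inherits the degree bounds, but its top parts
    -- may now involve the variable of index l.
    set G' := G /ₘ (Polynomial.X - Polynomial.C u) with hG'
    have hGnat : G.natDegree = l + 1 :=
      le_antisymm hdeg (Polynomial.le_natDegree_of_ne_zero (by rw [htop]; simp))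
    have hG'deg : G'.natDegree ≤ l := by
      rw [hG', Polynomial.natDegree_divByMonic _ (Polynomial.monic_X_sub_C u), hGnat]
      simp
    obtain ⟨g, hg, hgG⟩ := ih (by omega) G' hG'deg
      (by rw [hG', Polynomial.coeff_divByMonic_X_sub_C, hGnat]; simp [htop])
      (fun b hb => by
        rw [hG', Polynomial.coeff_divByMonic_X_sub_C, hGnat]
        refine Submodule.sum_mem _ fun i hi => ?_
        rw [Finset.mem_Icc] at hi
        have := mul_mem_topPartFrom (hu_mem (i - (b + 1)))
          (topPartFrom_anti (Nat.le_succ l) (hG i hi.2))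
        rwa [show 2 * (i - (b + 1)) + 2 * (l + 1 - i) = 2 * (l - b) by omega] at this)
    have hne (i : Fin n) (hi : (i : ℕ) < l) : i ≠ i₀ := by
      rintro rfl
      exact hi.false
    have himage : g '' {i | (i : ℕ) < l} ⊆
        Function.update g i₀ (G.eval u) '' {i | (i : ℕ) < l + 1} := by
      rintro _ ⟨i, hi, rfl⟩
      exact ⟨i, Nat.lt_succ_of_lt hi, Function.update_of_ne (hne i hi) _ _⟩
    -- The new generator is the remainder G(u). Its term -u^(l+1) is a pure power; the top parts of
    -- the other coefficients avoid the variable of index l and all earlier ones, so the other terms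
    -- of top degree have a smaller exponent there.
    refine ⟨Function.update g i₀ (G.eval u), fun i hi => ?_, fun b => ?_⟩
    · rcases (Nat.lt_succ_iff_lt_or_eq.1 hi) with h | h
      · rw [Function.update_of_ne (hne i h)]
        exact hg i h
      · obtain rfl : i = i₀ := Fin.ext h
        rw [Function.update_self, Polynomial.eval_eq_sum_range, hGnat, Finset.sum_range_succ, htop,
          add_comm]
        have : (-1 : MvPolynomial (Fin n) k) * u ^ (l + 1) =
            monomial (Finsupp.single i₀ (2 * (l + 1))) (-1) := by
          rw [hu, ← pow_mul, ← C_1, ← C_neg, C_mul_X_pow_eq_monomial]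
        rw [this]
        refine degree_degLex_eq_single (neg_ne_zero.2 one_ne_zero) fun s hs => ?_
        obtain ⟨b, hb, hs⟩ := Finset.mem_biUnion.1 (support_sum hs)
        rw [Finset.mem_range] at hb
        obtain ⟨t, ht, t', ht', rfl⟩ := Finset.mem_add.1 (support_mul _ _ hs)
        obtain ⟨h1, h2⟩ := mem_topPartFrom.1 (hG b hb.le) t ht
        have ht'' : t' = Finsupp.single i₀ (2 * b) := by
          rw [hu, ← pow_mul, support_X_pow] at ht'
          exact Finset.mem_singleton.1 ht'
        subst ht''
        rw [map_add, Finsupp.degree_single]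
        refine ⟨by omega, fun h => ?_⟩
        have h3 := h2 (by omega)
        refine ⟨fun j hj => ?_, ?_⟩
        · rw [Finsupp.add_apply, h3 j (Nat.lt_succ_of_lt hj), Finsupp.single_eq_of_ne hj.ne,
            add_zero]
        · rw [Finsupp.add_apply, h3 i₀ (Nat.lt_succ_self l), Finsupp.single_eq_same]
          omega
    · have hprod : ∏ i : Fin n with i.val < l + 1, (Polynomial.X - Polynomial.C (X i ^ 2)) =
          (Polynomial.X - Polynomial.C u) * ∏ i : Fin n with i.val < l,
            (Polynomial.X - Polynomial.C (X i ^ 2 : MvPolynomial (Fin n) k)) := by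
        have hins : (Finset.univ.filter fun i : Fin n => (i : ℕ) < l + 1) =
            insert i₀ (Finset.univ.filter fun i : Fin n => (i : ℕ) < l) := by
          ext i
          simp [i₀, Fin.ext_iff]
          omega
        rw [hins, Finset.prod_insert (by simp [i₀])]
      -- The nodal product vanishes at u, so only G contributes to the remainder there.
      have hsplit : ∏ i : Fin n with i.val < l + 1, (Polynomial.X - Polynomial.C (X i ^ 2)) + G =
          (Polynomial.X - Polynomial.C u) * (∏ i : Fin n with i.val < l,
            (Polynomial.X - Polynomial.C (X i ^ 2)) + G') + Polynomial.C (G.eval u) := by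
        rw [hprod, mul_add, add_assoc]
        congr 1
        rw [add_comm, ← Polynomial.modByMonic_X_sub_C_eq_C_eval]
        exact (Polynomial.modByMonic_add_div G _).symm
      have hgG' (b : ℕ) := Ideal.span_mono himage (hgG b)
      rw [hsplit, Polynomial.coeff_add, sub_mul, Polynomial.coeff_sub, Polynomial.coeff_C_mul,
        Polynomial.coeff_C]
      refine Ideal.add_mem _ (Ideal.sub_mem _ ?_ (Ideal.mul_mem_left _ _ (hgG' b))) ?_
      · cases b with
        | zero => simp
        | succ b => rw [Polynomial.coeff_X_mul]; exact hgG' b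
      · split_ifs
        · exact Ideal.subset_span ⟨i₀, Nat.lt_succ_self l, Function.update_self _ _ _⟩
        · exact Ideal.zero_mem _

end

/-! ### Symmetries of the discriminant -/

section
variable {R S : Type*} [CommRing R] [CommRing S]

theorem transferMatrix_succ_apply_zero (x : ℕ → R) (n : ℕ) (i : Fin 2) :
    transferMatrix x (n + 1) i 0 = transferMatrix x n i 0 * x n + transferMatrix x n i 1 := by
  simp [transferMatrix_succ, transferStep, Matrix.mul_apply, Fin.sum_univ_two]

theorem transferMatrix_succ_apply_one (x : ℕ → R) (n : ℕ) (i : Fin 2) :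
    transferMatrix x (n + 1) i 1 = -transferMatrix x n i 0 := by
  simp [transferMatrix_succ, transferStep, Matrix.mul_apply, Fin.sum_univ_two]

theorem transferMatrix_congr {x y : ℕ → R} {n : ℕ} (h : ∀ i < n, x i = y i) :
    transferMatrix x n = transferMatrix y n := by
  rw [transferMatrix, transferMatrix]
  congr 1
  exact List.map_congr_left fun i hi => by rw [h i (List.mem_range.1 hi)]

theorem transferStep_neg (x : R) :
    transferStep (-x) = -(!![1, 0; 0, -1] * transferStep x * !![1, 0; 0, -1]) := by
  simp [transferStep]

theorem transferStep_transpose (x : R) :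
    (transferStep x).transpose = !![1, 0; 0, -1] * transferStep x * !![1, 0; 0, -1] := by
  ext i j
  fin_cases i <;> fin_cases j <;> simp [transferStep]

theorem reflection_mul_self : (!![1, 0; 0, -1] : Matrix (Fin 2) (Fin 2) R) * !![1, 0; 0, -1] = 1 := by
  simp [Matrix.one_fin_two]

theorem trace_transferMatrix_neg (x : ℕ → R) (n : ℕ) :
    (transferMatrix (fun i => -x i) n).trace = (-1) ^ n * (transferMatrix x n).trace := by
  have h : transferMatrix (fun i => -x i) n =
      (-1 : R) ^ n • (!![1, 0; 0, -1] * transferMatrix x n * !![1, 0; 0, -1]) := by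
    induction n with
    | zero => simp [transferMatrix_zero, Matrix.one_fin_two]
    | succ n ih =>
      have e (A B J : Matrix (Fin 2) (Fin 2) R) (hJ : J * J = 1) :
          J * A * J * (J * B * J) = J * (A * B) * J := by
        rw [mul_assoc (J * A) J, ← mul_assoc J (J * B), ← mul_assoc J J, hJ, one_mul]
        simp only [mul_assoc]
      rw [transferMatrix_succ, transferMatrix_succ, ih, transferStep_neg, smul_mul_assoc,
        mul_neg, e _ _ _ reflection_mul_self, pow_succ, mul_neg_one, neg_smul, smul_neg]
  rw [h, Matrix.trace_smul, Matrix.trace_mul_comm, ← mul_assoc, reflection_mul_self, one_mul,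
    smul_eq_mul]

/-- Transposition reverses the product, and each transposed step is conjugate to itself by the same
reflection diag(1, -1). -/
theorem trace_transferMatrix_reverse (x : ℕ → R) (n : ℕ) :
    (transferMatrix (fun i => x (n - 1 - i)) n).trace = (transferMatrix x n).trace := by
  have h : transferMatrix (fun i => x (n - 1 - i)) n =
      !![1, 0; 0, -1] * (transferMatrix x n).transpose * !![1, 0; 0, -1] := by
    induction n with
    | zero => simp only [transferMatrix_zero, Matrix.transpose_one, mul_one, reflection_mul_self]
    | succ n ih =>
      have e (A B J : Matrix (Fin 2) (Fin 2) R) (hJ : J * J = 1) :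
          A * (J * B * J) = J * (J * A * J * B) * J := by
        simp only [← mul_assoc, hJ, one_mul]
      rw [transferMatrix_succ', transferMatrix_succ, Matrix.transpose_mul, transferStep_transpose,
        ← e _ _ _ reflection_mul_self, ← ih]
      congr 1
      refine transferMatrix_congr fun i hi => ?_
      congr 1
      omega
  rw [h, Matrix.trace_mul_comm, ← mul_assoc, reflection_mul_self, one_mul, Matrix.trace_transpose]

/-- The discriminant of a potential that is odd under the reflection of a period has the parity of
the period. -/
theorem coeff_trace_transferMatrix_of_odd {n : ℕ} {v : ℕ → R} (hv : ∀ i < n, v (n - 1 - i) = -v i)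
    (b : ℕ) :
    (transferMatrix (fun i => Polynomial.X - Polynomial.C (v i)) n).trace.coeff b =
      (-1) ^ (n + b) *
        (transferMatrix (fun i => Polynomial.X - Polynomial.C (v i)) n).trace.coeff b := by
  set p := (transferMatrix (fun i => Polynomial.X - Polynomial.C (v i)) n).trace with hp
  -- For odd v, replacing λ by -λ turns λ - v_i into the negative of λ - v_(n-1-i), so negation and
  -- reversal combine.
  have hcomp : p.comp (-Polynomial.X) = (-1) ^ n * p := by
    have h1 := congrArg Matrix.trace (transferMatrix_map (Polynomial.compRingHom (-Polynomial.X))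
      (fun i => Polynomial.X - Polynomial.C (v i)) n)
    have h2 : ((transferMatrix (fun i => Polynomial.X - Polynomial.C (v i)) n).map
        (Polynomial.compRingHom (-Polynomial.X))).trace = p.comp (-Polynomial.X) := by
      simp [hp, Matrix.trace_fin_two]
    rw [← h2, h1, hp, ← trace_transferMatrix_reverse (fun i => Polynomial.X - Polynomial.C (v i)),
      ← trace_transferMatrix_neg]
    congr 1
    refine transferMatrix_congr fun i hi => ?_
    rw [hv i hi]
    simp
    ring
  have h := congrArg (fun p => Polynomial.coeff p b) hcomp
  rw [show (-Polynomial.X : Polynomial R) = Polynomial.C (-1) * Polynomial.X by simp,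
    show ((-1) ^ n : Polynomial R) = Polynomial.C ((-1) ^ n) by simp,
    Polynomial.comp_C_mul_X_coeff, Polynomial.coeff_C_mul] at h
  rw [pow_add, mul_right_comm, ← h, mul_assoc, ← mul_pow]
  simp

end

/-! ### The leading form of the discriminant -/

section
open MvPolynomial
variable {σ k : Type*} [Field k]

variable (σ k) in
/-- Polynomials in `t` over `k[σ]` all of whose monomials have total degree less than `n`, with `t`
counted in degree one. -/
def jointDegreeLT (n : ℕ) : AddSubgroup (Polynomial (MvPolynomial σ k)) where
  carrier := {p | ∀ b s, coeff s (p.coeff b) ≠ 0 → s.degree + b < n}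
  zero_mem' := by simp
  add_mem' := by
    intro p q hp hq b s h
    rw [Polynomial.coeff_add, coeff_add] at h
    by_cases h1 : coeff s (p.coeff b) = 0
    · exact hq b s fun h2 => h (by rw [h1, h2, add_zero])
    · exact hp b s h1
  neg_mem' := by
    intro p hp b s h
    exact hp b s fun h' => h (by rw [Polynomial.coeff_neg, coeff_neg, h', neg_zero])

theorem jointDegreeLT_mono {n n' : ℕ} (h : n ≤ n') : jointDegreeLT σ k n ≤ jointDegreeLT σ k n' :=
  fun _ hp b s hs => (hp b s hs).trans_le h

theorem mul_X_sub_C_mem_jointDegreeLT {n : ℕ} {p : Polynomial (MvPolynomial σ k)}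
    (hp : p ∈ jointDegreeLT σ k n) {v : MvPolynomial σ k} (hv : v.totalDegree ≤ 1) :
    p * (Polynomial.X - Polynomial.C v) ∈ jointDegreeLT σ k (n + 1) := by
  classical
  rw [mul_sub]
  refine sub_mem (fun b s h => ?_) (fun b s h => ?_)
  · cases b with
    | zero => simp at h
    | succ b =>
      rw [Polynomial.coeff_mul_X] at h
      have := hp b s h
      omega
  · rw [Polynomial.coeff_mul_C] at h
    obtain ⟨t, ht, t', ht', rfl⟩ := Finset.mem_add.1 (support_mul _ _ (mem_support_iff.2 h))
    have h1 := hp b t (mem_support_iff.1 ht)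
    have h2 : t'.degree ≤ 1 := (le_totalDegree ht').trans hv
    rw [map_add]
    omega

/-- Every term other than the full product uses a constant entry of a step and loses degree. The
bounds are only as sharp as the induction needs; the weaker one for the last entry accommodates the
identity at n = 0. -/
theorem transferMatrix_jointDegree {v : ℕ → MvPolynomial σ k} (hv : ∀ i, (v i).totalDegree ≤ 1)
    (n : ℕ) :
    (∏ i ∈ Finset.range n, (Polynomial.X - Polynomial.C (v i))) ∈ jointDegreeLT σ k (n + 1) ∧
    transferMatrix (fun i => Polynomial.X - Polynomial.C (v i)) n 0 0 -
      ∏ i ∈ Finset.range n, (Polynomial.X - Polynomial.C (v i)) ∈ jointDegreeLT σ k n ∧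
    transferMatrix (fun i => Polynomial.X - Polynomial.C (v i)) n 0 1 ∈ jointDegreeLT σ k n ∧
    transferMatrix (fun i => Polynomial.X - Polynomial.C (v i)) n 1 0 ∈ jointDegreeLT σ k n ∧
    transferMatrix (fun i => Polynomial.X - Polynomial.C (v i)) n 1 1 ∈
      jointDegreeLT σ k (n + 1) := by
  classical
  induction n with
  | zero =>
    have h1 : (1 : Polynomial (MvPolynomial σ k)) ∈ jointDegreeLT σ k (0 + 1) := by
      intro b s h
      rw [Polynomial.coeff_one] at h
      split_ifs at h with hb
      · have hs : s = 0 := by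
          by_contra hs
          exact h (by rw [coeff_one, if_neg (Ne.symm hs)])
        simp [hs, hb]
      · simp at h
    simp [transferMatrix_zero, h1]
  | succ n ih =>
    obtain ⟨h0, hA, hB, hC, hD⟩ := ih
    have hA' := add_mem (jointDegreeLT_mono (Nat.le_succ n) hA) h0
    rw [sub_add_cancel] at hA'
    rw [Finset.prod_range_succ]
    simp only [transferMatrix_succ_apply_zero, transferMatrix_succ_apply_one]
    refine ⟨mul_X_sub_C_mem_jointDegreeLT h0 (hv n), ?_, neg_mem hA',
      add_mem (mul_X_sub_C_mem_jointDegreeLT hC (hv n)) hD,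
      neg_mem (jointDegreeLT_mono (show n ≤ n + 1 + 1 by omega) hC)⟩
    rw [add_sub_right_comm, ← sub_mul]
    exact add_mem (mul_X_sub_C_mem_jointDegreeLT hA (hv n)) (jointDegreeLT_mono (Nat.le_succ n) hB)

theorem trace_transferMatrix_sub_prod_mem {v : ℕ → MvPolynomial σ k}
    (hv : ∀ i, (v i).totalDegree ≤ 1) {n : ℕ} (hn : 0 < n) :
    (transferMatrix (fun i => Polynomial.X - Polynomial.C (v i)) n).trace -
      ∏ i ∈ Finset.range n, (Polynomial.X - Polynomial.C (v i)) ∈ jointDegreeLT σ k n := by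
  obtain ⟨n, rfl⟩ := Nat.exists_eq_succ_of_ne_zero hn.ne'
  rw [Matrix.trace_fin_two, add_sub_right_comm]
  refine add_mem (transferMatrix_jointDegree hv _).2.1 ?_
  -- The bound just proved for the lower right entry is one too weak; as minus the lower left entry
  -- one site earlier it satisfies the required one.
  rw [transferMatrix_succ_apply_one]
  exact neg_mem (jointDegreeLT_mono (Nat.le_succ n) (transferMatrix_jointDegree hv n).2.2.2.1)

end

/-! ### Odd potentials -/

section
variable {R S : Type*} [CommRing R] [CommRing S]

/-- The potential on `0, …, q - 1` that is odd under `i ↦ q - 1 - i` and starts with `y`. -/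
def oddExtension {m : ℕ} (q : ℕ) (y : Fin m → R) (i : ℕ) : R :=
  if h : i < m then y ⟨i, h⟩ else if h : q - 1 - i < m then -y ⟨q - 1 - i, h⟩ else 0

theorem map_oddExtension (f : R →+* S) {m : ℕ} (q : ℕ) (y : Fin m → R) (i : ℕ) :
    f (oddExtension q y i) = oddExtension q (fun j => f (y j)) i := by
  unfold oddExtension
  split_ifs <;> simp

theorem oddExtension_val {m : ℕ} (q : ℕ) (y : Fin m → R) (j : Fin m) :
    oddExtension q y j = y j := by
  simp [oddExtension]

variable {m e : ℕ} (y : Fin m → R)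

theorem oddExtension_mid {i : ℕ} (hi : i < e) (he : e ≤ 1) :
    oddExtension (m + e + m) y (m + i) = 0 := by
  rw [oddExtension, dif_neg (by omega), dif_neg (by omega)]

theorem oddExtension_right (j : Fin m) :
    oddExtension (m + e + m) y (m + e + (m - 1 - j)) = -y j := by
  have h : m + e + m - 1 - (m + e + (m - 1 - j)) = j := by omega
  rw [oddExtension, dif_neg (by omega), dif_pos (by omega)]
  congr 2
  exact Fin.ext h

theorem oddExtension_reflect (he : e ≤ 1) {i : ℕ} (hi : i < m + e + m) :
    oddExtension (m + e + m) y (m + e + m - 1 - i) = -oddExtension (m + e + m) y i := by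
  by_cases h1 : i < m
  · rw [show m + e + m - 1 - i = m + e + (m - 1 - (⟨i, h1⟩ : Fin m)) by simp; omega,
      oddExtension_right, ← oddExtension_val (m + e + m) y ⟨i, h1⟩]
  · by_cases h2 : m + e + m - 1 - i < m
    · rw [oddExtension, dif_pos h2, oddExtension, dif_neg h1, dif_pos h2, neg_neg]
    · rw [oddExtension, dif_neg h2, dif_neg (by omega), oddExtension, dif_neg h1, dif_neg h2,
        neg_zero]

theorem prod_range_reflect_split (e : ℕ) (f : ℕ → R) :
    ∏ i ∈ Finset.range (m + e + m), f i =
      (∏ i ∈ Finset.range e, f (m + i)) * ∏ j : Fin m, f j * f (m + e + (m - 1 - j)) := by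
  rw [Finset.prod_range_add, Finset.prod_range_add, ← Finset.prod_range_reflect (fun i => f (m + e + i)),
    Finset.prod_range, ← Fin.prod_univ_eq_prod_range (fun i => f (m + e + (m - 1 - i))),
    Finset.prod_mul_distrib]
  ring

theorem sum_oddExtension_mul (he : e ≤ 1) (f : ℕ → R) :
    ∑ i ∈ Finset.range (m + e + m), oddExtension (m + e + m) y i * f i =
      ∑ j : Fin m, y j * (f j - f (m + e + (m - 1 - j))) := by
  rw [Finset.sum_range_add, Finset.sum_range_add,
    ← Finset.sum_range_reflect (fun i => oddExtension _ y (m + e + i) * f (m + e + i)),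
    Finset.sum_range, ← Fin.sum_univ_eq_sum_range (fun i => oddExtension (m + e + m) y
      (m + e + (m - 1 - i)) * f (m + e + (m - 1 - i))),
    Finset.sum_eq_zero (s := Finset.range e) fun i hi => by
      rw [oddExtension_mid y (Finset.mem_range.1 hi) he, zero_mul],
    add_zero, ← Finset.sum_add_distrib]
  refine Finset.sum_congr rfl fun j _ => ?_
  rw [oddExtension_val, oddExtension_right]
  ring

/-- Reflected sites pair up as (t - y)(t + y) = t² - y², and a middle site contributes t. -/
theorem prod_X_sub_C_oddExtension (he : e ≤ 1) :
    ∏ i ∈ Finset.range (m + e + m), (Polynomial.X - Polynomial.C (oddExtension (m + e + m) y i)) =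
      Polynomial.X ^ e * Polynomial.expand R 2 (∏ j : Fin m,
        (Polynomial.X - Polynomial.C (y j ^ 2))) := by
  rw [prod_range_reflect_split, map_prod]
  congr 1
  · rw [Finset.prod_congr rfl fun i hi => by
      rw [oddExtension_mid y (Finset.mem_range.1 hi) he, map_zero, sub_zero], Finset.prod_const,
      Finset.card_range]
  · refine Finset.prod_congr rfl fun j _ => ?_
    rw [oddExtension_val, oddExtension_right]
    simp
    ring

end

/-! ### Generators for the invariants of odd potentials -/

section
open MvPolynomial MonomialOrder
open scoped MonomialOrder

variable {k : Type*} [Field k]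

theorem oddExtension_zero {R : Type*} [CommRing R] {m : ℕ} (q i : ℕ) :
    oddExtension q (0 : Fin m → R) i = 0 := by
  simp [oddExtension]

theorem totalDegree_oddExtension_X_le {m : ℕ} (q i : ℕ) :
    (oddExtension q (X : Fin m → MvPolynomial (Fin m) k) i).totalDegree ≤ 1 := by
  unfold oddExtension
  split_ifs
  · rw [totalDegree_X]
  · rw [totalDegree_neg, totalDegree_X]
  · simp

/-- The spectral invariants of odd potentials lie in an ideal generated by polynomials with pure
powers as leading monomials. -/
theorem exists_generators_of_oddExtension [CharZero k] {m e : ℕ} (hm : 0 < m) (he : e ≤ 1) :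
    ∃ g : Fin m → MvPolynomial (Fin m) k,
      (∀ i : Fin m, degLex.degree (g i) = Finsupp.single i (2 * ((i : ℕ) + 1))) ∧
      ∀ b, ((transferMatrix (fun i => Polynomial.X - Polynomial.C (oddExtension (m + e + m)
          (X : Fin m → MvPolynomial (Fin m) k) i)) (m + e + m)).trace -
        (transferMatrix (fun _ => Polynomial.X) (m + e + m)).trace).coeff b ∈
          Ideal.span (Set.range g) := by
  set q := m + e + m with hq
  set v := oddExtension q (X : Fin m → MvPolynomial (Fin m) k) with hv
  set T := (transferMatrix (fun i => Polynomial.X - Polynomial.C (v i)) q).trace with hT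
  set T₀ := (transferMatrix (fun _ => (Polynomial.X : Polynomial (MvPolynomial (Fin m) k)))
    q).trace with hT₀
  set P := ∏ i ∈ Finset.range q, (Polynomial.X - Polynomial.C (v i)) with hP
  have h0 : T₀ = (transferMatrix (fun i => Polynomial.X - Polynomial.C
      (oddExtension q (0 : Fin m → MvPolynomial (Fin m) k) i)) q).trace := by
    simp [hT₀, oddExtension_zero]
  have hE : T - T₀ - (P - Polynomial.X ^ q) ∈ jointDegreeLT (Fin m) k q := by
    have h1 := trace_transferMatrix_sub_prod_mem (n := q)
      (totalDegree_oddExtension_X_le (k := k) (m := m) q) (by omega)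
    have h2 := trace_transferMatrix_sub_prod_mem (n := q) (v := fun _ => (0 : MvPolynomial (Fin m) k))
      (by simp) (by omega)
    simp only [map_zero, sub_zero, Finset.prod_const, Finset.card_range] at h2
    have := sub_mem h1 h2
    rwa [sub_sub_sub_comm] at this
  set E := T - T₀ - (P - Polynomial.X ^ q) with hEdef
  have hEtop (b : ℕ) (hb : q ≤ b) : E.coeff b = 0 := by
    ext s
    by_contra h
    have := hE b s h
    omega
  have hodd (b : ℕ) (hb : Odd (q + b)) : (T - T₀).coeff b = 0 := by
    have h1 := coeff_trace_transferMatrix_of_odd (n := q) (v := v)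
      (fun i hi => oddExtension_reflect _ he hi) b
    have h2 := coeff_trace_transferMatrix_of_odd (n := q)
      (v := oddExtension q (0 : Fin m → MvPolynomial (Fin m) k))
      (fun i hi => oddExtension_reflect _ he hi) b
    rw [← h0] at h2
    rw [hb.neg_one_pow, neg_one_mul] at h1 h2
    rw [Polynomial.coeff_sub, self_eq_neg.1 h1, self_eq_neg.1 h2, sub_zero]
  -- By parity T - T₀ is t^e times a polynomial in t², namely the nodal product at the y_j² plus G.
  -- The term -t^q with q = 2m + e gives G its top coefficient -1.
  set G : Polynomial (MvPolynomial (Fin m) k) := ∑ b ∈ Finset.range (m + 1),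
    Polynomial.monomial b ((E - Polynomial.X ^ q).coeff (2 * b + e)) with hG
  have hGcoeff (b : ℕ) : G.coeff b = (E - Polynomial.X ^ q).coeff (2 * b + e) := by
    rw [hG, Polynomial.finsetSum_coeff]
    simp only [Polynomial.coeff_monomial, Finset.sum_ite_eq', Finset.mem_range]
    split_ifs with hb
    · rfl
    · rw [Polynomial.coeff_sub, hEtop _ (by omega), Polynomial.coeff_X_pow, if_neg (by omega),
        sub_zero]
  have hGdeg : G.natDegree ≤ m := by
    rw [Polynomial.natDegree_le_iff_coeff_eq_zero]
    intro b hb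
    rw [hGcoeff, Polynomial.coeff_sub, hEtop _ (by omega), Polynomial.coeff_X_pow,
      if_neg (by omega), sub_zero]
  have hGtop : G.coeff m = -1 := by
    rw [hGcoeff, Polynomial.coeff_sub, hEtop _ (by omega), Polynomial.coeff_X_pow,
      if_pos (by omega), zero_sub]
  obtain ⟨g, hg, hgG⟩ := exists_generators_of_coeff m le_rfl G hGdeg hGtop (fun b hb => by
    rcases hb.lt_or_eq with hb | rfl
    · rw [hGcoeff, Polynomial.coeff_sub, Polynomial.coeff_X_pow, if_neg (by omega), sub_zero,
        mem_topPartFrom]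
      intro s hs
      have := hE _ s (mem_support_iff.1 hs)
      -- The degree bound from E is strict, so the condition on the top part is vacuous.
      exact ⟨by omega, fun h => by omega⟩
    · rw [hGtop, Nat.sub_self]
      exact Submodule.neg_mem _ (one_mem_topPartFrom _))
  have himage : g '' {i | (i : ℕ) < m} = Set.range g := by
    rw [← Set.image_univ]
    congr 1
    ext i
    simp
  refine ⟨g, fun i => hg i i.2, fun b => ?_⟩
  by_cases hb : Odd (q + b)
  · rw [hodd b hb]
    exact Ideal.zero_mem _
  · obtain ⟨b', rfl⟩ : ∃ b', b = 2 * b' + e := by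
      rw [Nat.not_odd_iff_even, Nat.even_iff] at hb
      exact ⟨b / 2, by omega⟩
    have hsum := hgG b'
    rw [himage, Finset.filter_true_of_mem fun i _ => i.2] at hsum
    have hTE : T - T₀ = P + (E - Polynomial.X ^ q) := by rw [hEdef]; ring
    rw [hTE, Polynomial.coeff_add, ← hGcoeff, hP, prod_X_sub_C_oddExtension _ he,
      Polynomial.coeff_X_pow_mul, mul_comm 2 b', Polynomial.coeff_expand_mul two_pos,
      ← Polynomial.coeff_add]
    exact hsum

end

/-! ### Second order perturbation at double eigenvalues -/

section
variable {R : Type*} [CommRing R]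

/-- The solution of `s (n + 2) = λ * s (n + 1) - s n` with `s 0 = 0` and `s 1 = 1`. -/
def freeSolution (l : R) : ℕ → R
  | 0 => 0
  | 1 => 1
  | n + 2 => l * freeSolution l (n + 1) - freeSolution l n

theorem freeSolution_add_two (l : R) (n : ℕ) :
    freeSolution l (n + 2) = l * freeSolution l (n + 1) - freeSolution l n := rfl

/-- This is the determinant of the free transfer matrix. -/
theorem freeSolution_wronskian (l : R) (n : ℕ) :
    freeSolution l (n + 1) ^ 2 - l * freeSolution l (n + 1) * freeSolution l n
      + freeSolution l n ^ 2 = 1 := by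
  induction n with
  | zero => simp [freeSolution]
  | succ n ih =>
    rw [freeSolution_add_two]
    linear_combination ih

theorem transferMatrix_const (l : R) (n : ℕ) :
    transferMatrix (fun _ => l) n = !![freeSolution l (n + 1), -freeSolution l n;
      freeSolution l n, freeSolution l (n + 1) - l * freeSolution l n] := by
  induction n with
  | zero => simp [transferMatrix_zero, freeSolution, Matrix.one_fin_two]
  | succ n ih =>
    rw [transferMatrix_succ, ih, freeSolution_add_two]
    ext i j
    fin_cases i <;> fin_cases j <;> simp [transferStep, Matrix.mul_apply, Fin.sum_univ_two] <;> ring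

theorem freeSolution_mul_sub {z z' : R} (h : z * z' = 1) (n : ℕ) :
    freeSolution (z + z') n * (z - z') = z ^ n - z' ^ n := by
  have h2 : freeSolution (z + z') n * (z - z') = z ^ n - z' ^ n ∧
      freeSolution (z + z') (n + 1) * (z - z') = z ^ (n + 1) - z' ^ (n + 1) := by
    induction n with
    | zero => simp [freeSolution]
    | succ n ih =>
      refine ⟨ih.2, ?_⟩
      rw [freeSolution_add_two, sub_mul, ih.1, mul_assoc, ih.2]
      linear_combination (z' ^ n - z ^ n) * -h
  exact h2.1

/-- The transfer matrix of `v` in the interaction picture: the ratio of the transfer matrices of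
`v` and of the zero potential. -/
def relativeTransfer (s v : ℕ → R) : ℕ → Matrix (Fin 2) (Fin 2) R
  | 0 => 1
  | n + 1 => relativeTransfer s v n *
      !![1 + v n * (s n * s (n + 1)), -(v n * s (n + 1) ^ 2);
        v n * s n ^ 2, 1 - v n * (s n * s (n + 1))]

/-- A step of l - v differs from a free step by a rank one matrix. Carrying it through the free
transfer matrices, which have determinant 1, gives the factors of `relativeTransfer`. -/
theorem transferMatrix_sub_eq (l : R) (v : ℕ → R) (n : ℕ) :
    transferMatrix (fun i => l - v i) n =
      relativeTransfer (freeSolution l) v n * transferMatrix (fun _ => l) n := by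
  induction n with
  | zero => simp [transferMatrix_zero, relativeTransfer]
  | succ n ih =>
    rw [transferMatrix_succ, ih, relativeTransfer, transferMatrix_succ, mul_assoc, mul_assoc,
      transferMatrix_const]
    congr 1
    have hw := freeSolution_wronskian l n
    ext i j
    fin_cases i <;> fin_cases j <;> simp [transferStep, Matrix.mul_apply, Fin.sum_univ_two]
    · linear_combination v n * freeSolution l (n + 1) * hw
    · ring
    · linear_combination v n * freeSolution l n * hw
    · ring

/-- Second order perturbation of the discriminant. -/
theorem trace_relativeTransfer_mem {J : Ideal R} (s : ℕ → R) {v : ℕ → R} (hv : ∀ i, v i ∈ J)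
    (n : ℕ) :
    (relativeTransfer s v n).trace - (2 + (∑ i ∈ Finset.range n, v i * (s i * s (i + 1))) ^ 2
      - (∑ i ∈ Finset.range n, v i * s (i + 1) ^ 2) * ∑ i ∈ Finset.range n, v i * s i ^ 2) ∈
      J ^ 3 := by
  set a : ℕ → R := fun n => ∑ i ∈ Finset.range n, v i * (s i * s (i + 1)) with ha
  set b : ℕ → R := fun n => ∑ i ∈ Finset.range n, v i * s (i + 1) ^ 2 with hb
  set c : ℕ → R := fun n => ∑ i ∈ Finset.range n, v i * s i ^ 2 with hc
  have haJ (n : ℕ) : a n ∈ J := Ideal.sum_mem _ fun i _ => Ideal.mul_mem_right _ _ (hv i)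
  have hbJ (n : ℕ) : b n ∈ J := Ideal.sum_mem _ fun i _ => Ideal.mul_mem_right _ _ (hv i)
  have hcJ (n : ℕ) : c n ∈ J := Ideal.sum_mem _ fun i _ => Ideal.mul_mem_right _ _ (hv i)
  have hsq : J ^ 2 ≤ J := Ideal.pow_le_self two_ne_zero
  have hmul2 {x y : R} (hx : x ∈ J) (hy : y ∈ J) : x * y ∈ J ^ 2 := by
    rw [pow_two]; exact Ideal.mul_mem_mul hx hy
  have hmul3 {x y : R} (hx : x ∈ J) (hy : y ∈ J ^ 2) : x * y ∈ J ^ 3 := by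
    rw [pow_succ' J 2]; exact Ideal.mul_mem_mul hx hy
  -- Each factor is 1 plus a nilpotent matrix, so the product M has determinant 1 and trace 2 -
  -- det(M - 1), with second order part a² - bc. The induction also carries the first order parts of
  -- the entries, which control the increment of the trace.
  suffices h : relativeTransfer s v n 0 0 - (1 + a n) ∈ J ^ 2 ∧
      relativeTransfer s v n 0 1 + b n ∈ J ^ 2 ∧ relativeTransfer s v n 1 0 - c n ∈ J ^ 2 ∧
      relativeTransfer s v n 1 1 - (1 - a n) ∈ J ^ 2 ∧
      relativeTransfer s v n 0 0 + relativeTransfer s v n 1 1 - (2 + a n ^ 2 - b n * c n) ∈ J ^ 3 by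
    rw [Matrix.trace_fin_two]
    exact h.2.2.2.2
  induction n with
  | zero => simp [relativeTransfer, ha, hb, hc]; norm_num
  | succ n ih =>
    obtain ⟨h1, h2, h3, h4, h5⟩ := ih
    have ha' : a (n + 1) = a n + v n * (s n * s (n + 1)) := Finset.sum_range_succ _ _
    have hb' : b (n + 1) = b n + v n * s (n + 1) ^ 2 := Finset.sum_range_succ _ _
    have hc' : c (n + 1) = c n + v n * s n ^ 2 := Finset.sum_range_succ _ _
    have e00 : relativeTransfer s v (n + 1) 0 0 = relativeTransfer s v n 0 0 *
        (1 + v n * (s n * s (n + 1))) + relativeTransfer s v n 0 1 * (v n * s n ^ 2) := by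
      simp [relativeTransfer, Matrix.mul_apply, Fin.sum_univ_two]
    have e01 : relativeTransfer s v (n + 1) 0 1 = relativeTransfer s v n 0 0 *
        (-(v n * s (n + 1) ^ 2)) + relativeTransfer s v n 0 1 *
          (1 - v n * (s n * s (n + 1))) := by
      simp [relativeTransfer, Matrix.mul_apply, Fin.sum_univ_two]
    have e10 : relativeTransfer s v (n + 1) 1 0 = relativeTransfer s v n 1 0 *
        (1 + v n * (s n * s (n + 1))) + relativeTransfer s v n 1 1 * (v n * s n ^ 2) := by
      simp [relativeTransfer, Matrix.mul_apply, Fin.sum_univ_two]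
    have e11 : relativeTransfer s v (n + 1) 1 1 = relativeTransfer s v n 1 0 *
        (-(v n * s (n + 1) ^ 2)) + relativeTransfer s v n 1 1 *
          (1 - v n * (s n * s (n + 1))) := by
      simp [relativeTransfer, Matrix.mul_apply, Fin.sum_univ_two]
    rw [e00, e01, e10, e11, ha', hb', hc']
    generalize relativeTransfer s v n 0 0 = p at *
    generalize relativeTransfer s v n 0 1 = q at *
    generalize relativeTransfer s v n 1 0 = r at *
    generalize relativeTransfer s v n 1 1 = t at *
    have hp : p - 1 ∈ J := by
      convert J.add_mem (hsq h1) (haJ n) using 1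
      ring
    have hq : q ∈ J := by
      convert J.sub_mem (hsq h2) (hbJ n) using 1
      ring
    have hr : r ∈ J := by
      convert J.add_mem (hsq h3) (hcJ n) using 1
      ring
    have ht : t - 1 ∈ J := by
      convert J.sub_mem (hsq h4) (haJ n) using 1
      ring
    refine ⟨?_, ?_, ?_, ?_, ?_⟩
    · convert (J ^ 2).add_mem h1 (hmul2 (hv n) (J.add_mem (J.mul_mem_right (s n * s (n + 1)) hp)
        (J.mul_mem_right (s n ^ 2) hq))) using 1
      ring
    · convert (J ^ 2).sub_mem h2 (hmul2 (hv n) (J.add_mem (J.mul_mem_right (s (n + 1) ^ 2) hp)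
        (J.mul_mem_right (s n * s (n + 1)) hq))) using 1
      ring
    · convert (J ^ 2).add_mem h3 (hmul2 (hv n) (J.add_mem (J.mul_mem_right (s n * s (n + 1)) hr)
        (J.mul_mem_right (s n ^ 2) ht))) using 1
      ring
    · convert (J ^ 2).sub_mem h4 (hmul2 (hv n) (J.add_mem (J.mul_mem_right (s (n + 1) ^ 2) hr)
        (J.mul_mem_right (s n * s (n + 1)) ht))) using 1
      ring
    · convert (J ^ 3).add_mem h5 (hmul3 (hv n) ((J ^ 2).add_mem
        ((J ^ 2).mul_mem_right (s n * s (n + 1)) ((J ^ 2).sub_mem h1 h4))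
        ((J ^ 2).sub_mem ((J ^ 2).mul_mem_right (s n ^ 2) h2)
          ((J ^ 2).mul_mem_right (s (n + 1) ^ 2) h3)))) using 1
      ring

/-- Reflection replaces x^i by x^(q-1-i) = x'^(i+1): Fourier coefficients of odd potentials at
inverse frequencies are proportional. -/
theorem sum_mul_pow_eq_of_odd {q : ℕ} {v : ℕ → R} (hodd : ∀ i < q, v (q - 1 - i) = -v i)
    {x x' : R} (hx : x * x' = 1) (hq : x ^ q = 1) :
    ∑ i ∈ Finset.range q, v i * x ^ i = -(x' * ∑ i ∈ Finset.range q, v i * x' ^ i) := by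
  rw [← Finset.sum_range_reflect, Finset.mul_sum, ← Finset.sum_neg_distrib]
  refine Finset.sum_congr rfl fun i hi => ?_
  rw [Finset.mem_range] at hi
  have h1 : x ^ (q - 1 - i) * x ^ (i + 1) = 1 := by
    rw [← pow_add, show q - 1 - i + (i + 1) = q by omega, hq]
  have h2 : x ^ (i + 1) * x' ^ (i + 1) = 1 := by rw [← mul_pow, hx, one_pow]
  have h3 : x ^ (q - 1 - i) = x' ^ (i + 1) := by
    linear_combination x' ^ (i + 1) * h1 - x ^ (q - 1 - i) * h2
  rw [hodd i hi, h3]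
  ring

/-- At a double eigenvalue `z + z⁻¹` of the periodic or antiperiodic problem, the discriminant of
an odd potential differs from the free one by a square of a linear form, to second order. -/
theorem sq_mem_of_odd {q : ℕ} {I J : Ideal R} {v : ℕ → R} (hv : ∀ i, v i ∈ J)
    (hodd : ∀ i < q, v (q - 1 - i) = -v i) (hsum : ∑ i ∈ Finset.range q, v i = 0) {z z' : R}
    (hz : z * z' = 1) (hd : IsUnit (z - z')) (hq : z ^ q = z' ^ q)
    (hI : (transferMatrix (fun i => z + z' - v i) q).trace -
      (transferMatrix (fun _ => z + z') q).trace ∈ I) :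
    (∑ i ∈ Finset.range q, v i * (z ^ 2) ^ i) ^ 2 ∈ I ⊔ J ^ 3 := by
  set s := freeSolution (z + z') with hs
  set A := ∑ i ∈ Finset.range q, v i * (z ^ 2) ^ i with hA
  set B := ∑ i ∈ Finset.range q, v i * (z' ^ 2) ^ i with hB
  set a := ∑ i ∈ Finset.range q, v i * (s i * s (i + 1)) with ha
  set b := ∑ i ∈ Finset.range q, v i * s (i + 1) ^ 2 with hb
  set c := ∑ i ∈ Finset.range q, v i * s i ^ 2 with hc
  have hsd (i : ℕ) : s i * (z - z') = z ^ i - z' ^ i := freeSolution_mul_sub hz i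
  have hzi (i : ℕ) : z ^ i * z' ^ i = 1 := by rw [← mul_pow, hz, one_pow]
  -- Hence the free transfer matrix over a period is a scalar of square one, and the trace has no
  -- first order term.
  have hsq : s q = 0 := hd.mul_left_eq_zero.1 (by rw [hsd, hq, sub_self])
  have ha' : a * (z - z') ^ 2 = z * A + z' * B := by
    have : a * (z - z') ^ 2 = z * A + z' * B - (z + z') * ∑ i ∈ Finset.range q, v i := by
      rw [ha, hA, hB, Finset.sum_mul, Finset.mul_sum, Finset.mul_sum, Finset.mul_sum,
        ← Finset.sum_add_distrib, ← Finset.sum_sub_distrib]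
      refine Finset.sum_congr rfl fun i _ => ?_
      rw [show v i * (s i * s (i + 1)) * (z - z') ^ 2 =
        v i * ((s i * (z - z')) * (s (i + 1) * (z - z'))) by ring, hsd, hsd]
      linear_combination (-v i * (z + z')) * hzi i
    rw [this, hsum, mul_zero, sub_zero]
  have hb' : b * (z - z') ^ 2 = z ^ 2 * A + z' ^ 2 * B := by
    have : b * (z - z') ^ 2 = z ^ 2 * A + z' ^ 2 * B - 2 * ∑ i ∈ Finset.range q, v i := by
      rw [hb, hA, hB, Finset.sum_mul, Finset.mul_sum, Finset.mul_sum, Finset.mul_sum,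
        ← Finset.sum_add_distrib, ← Finset.sum_sub_distrib]
      refine Finset.sum_congr rfl fun i _ => ?_
      rw [show v i * s (i + 1) ^ 2 * (z - z') ^ 2 = v i * (s (i + 1) * (z - z')) ^ 2 by ring, hsd]
      linear_combination (-2 * v i) * hzi (i + 1)
    rw [this, hsum, mul_zero, sub_zero]
  have hc' : c * (z - z') ^ 2 = A + B := by
    have : c * (z - z') ^ 2 = A + B - 2 * ∑ i ∈ Finset.range q, v i := by
      rw [hc, hA, hB, Finset.sum_mul, Finset.mul_sum,
        ← Finset.sum_add_distrib, ← Finset.sum_sub_distrib]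
      refine Finset.sum_congr rfl fun i _ => ?_
      rw [show v i * s i ^ 2 * (z - z') ^ 2 = v i * (s i * (z - z')) ^ 2 by ring, hsd]
      linear_combination (-2 * v i) * hzi i
    rw [this, hsum, mul_zero, sub_zero]
  have hAB : A = -(z' ^ 2 * B) := by
    refine sum_mul_pow_eq_of_odd hodd (by rw [← mul_pow, hz, one_pow]) ?_
    rw [← pow_mul, mul_comm 2, pow_mul, pow_two]
    nth_rewrite 2 [hq]
    exact hzi q
  -- For v of mean zero the left side is -AB; oddness, as B = -z²A, turns this into a square.
  have hquad : (a ^ 2 - b * c) * (z - z') ^ 2 = z ^ 2 * A ^ 2 := by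
    have hd2 : IsUnit ((z - z') ^ 2) := hd.pow 2
    have hB' : B = -(z ^ 2 * A) := by
      rw [hAB]
      linear_combination (-B * (z * z' + 1)) * hz
    refine hd2.mul_left_cancel ?_
    calc (z - z') ^ 2 * ((a ^ 2 - b * c) * (z - z') ^ 2) =
        (a * (z - z') ^ 2) ^ 2 - (b * (z - z') ^ 2) * (c * (z - z') ^ 2) := by ring
      _ = (z * A + z' * B) ^ 2 - (z ^ 2 * A + z' ^ 2 * B) * (A + B) := by rw [ha', hb', hc']
      _ = (z - z') ^ 2 * (z ^ 2 * A ^ 2) := by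
        rw [hB']
        ring
  have hT (n : Matrix (Fin 2) (Fin 2) R) :
      (n * transferMatrix (fun _ => z + z') q).trace = s (q + 1) * n.trace := by
    rw [transferMatrix_const, ← hs, hsq]
    simp [Matrix.trace_fin_two, Matrix.mul_apply, Fin.sum_univ_two]
    ring
  have hsu : s (q + 1) * s (q + 1) = 1 := by
    have := freeSolution_wronskian (z + z') q
    rw [← hs, hsq] at this
    linear_combination this
  have hJ3 := trace_relativeTransfer_mem s hv q
  have h2 : (transferMatrix (fun _ => z + z') q).trace = s (q + 1) * 2 := by
    have := hT 1
    rwa [one_mul, Matrix.trace_one, Fintype.card_fin, Nat.cast_ofNat] at this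
  rw [transferMatrix_sub_eq, ← hs, hT, h2] at hI
  set t := (relativeTransfer s v q).trace with ht
  have hfin : A ^ 2 = z' ^ 2 * (z - z') ^ 2 * s (q + 1) * (s (q + 1) * t - s (q + 1) * 2)
      - z' ^ 2 * (z - z') ^ 2 * (t - (2 + a ^ 2 - b * c)) := by
    have h1 : z ^ 2 * z' ^ 2 = 1 := by rw [← mul_pow, hz, one_pow]
    linear_combination (-A ^ 2) * h1 - z' ^ 2 * hquad - z' ^ 2 * (z - z') ^ 2 * (t - 2) * hsu
  rw [hfin]
  exact Ideal.sub_mem _ (Ideal.mem_sup_left (I.mul_mem_left _ hI))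
    (Ideal.mem_sup_right ((J ^ 3).mul_mem_left _ hJ3))

end

/-! ### Fourier coefficients and existence of an odd solution -/

section
open MvPolynomial MonomialOrder
open scoped MonomialOrder

/-- Oddness gives the vanishing at frequency 0 and reflection that at q - j. The polynomial with
coefficients v_i, of degree below q, then vanishes at all q-th roots of unity. -/
theorem eq_zero_of_sum_mul_primitiveRoot_pow_eq_zero {k : Type*} [Field k] [CharZero k] {m e : ℕ}
    (he : e ≤ 1) {ω : k} (hω : IsPrimitiveRoot ω (m + e + m)) (y : Fin m → k)
    (h : ∀ j : Fin m, ∑ i ∈ Finset.range (m + e + m),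
      oddExtension (m + e + m) y i * (ω ^ ((j : ℕ) + 1)) ^ i = 0) : y = 0 := by
  rcases Nat.eq_zero_or_pos m with rfl | hm
  · exact Subsingleton.elim _ _
  set q := m + e + m with hq
  set p : Polynomial k := ∑ i ∈ Finset.range q, Polynomial.monomial i (oddExtension q y i) with hp
  have heval (x : k) : p.eval x = ∑ i ∈ Finset.range q, oddExtension q y i * x ^ i := by
    rw [hp, Polynomial.eval_finsetSum]
    simp
  have hrefl {x x' : k} (hxx : x * x' = 1) (hx : x ^ q = 1) (hp0 : p.eval x = 0) :
      p.eval x' = 0 := by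
    have h1 := sum_mul_pow_eq_of_odd (fun i hi => oddExtension_reflect y he hi) hxx hx
    rw [← heval, ← heval, hp0, eq_comm, neg_eq_zero] at h1
    exact (mul_eq_zero.1 h1).resolve_left (right_ne_zero_of_mul_eq_one hxx)
  have hroot (j : Fin q) : p.eval (ω ^ (j : ℕ)) = 0 := by
    rcases Nat.eq_zero_or_pos (j : ℕ) with hj | hj
    · rw [hj, pow_zero, heval]
      have := sum_oddExtension_mul y he (fun _ => 1)
      simpa using this
    · by_cases hjm : (j : ℕ) ≤ m
      · have := h ⟨j - 1, by omega⟩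
        simp only [Nat.sub_add_cancel hj] at this
        rw [heval]
        exact this
      · have := h ⟨q - j - 1, by omega⟩
        simp only at this
        rw [← heval, show q - (j : ℕ) - 1 + 1 = q - j by omega] at this
        refine hrefl ?_ ?_ this
        · rw [← pow_add, Nat.sub_add_cancel j.2.le, hω.pow_eq_one]
        · rw [← pow_mul, mul_comm, pow_mul, hω.pow_eq_one, one_pow]
  have hdeg : p.natDegree < Fintype.card (Fin q) := by
    rw [Fintype.card_fin]
    refine lt_of_le_of_lt (Polynomial.natDegree_sum_le_of_forall_le (n := q - 1) _ _ fun i hi => ?_)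
      (by omega)
    rw [Finset.mem_range] at hi
    exact (Polynomial.natDegree_monomial_le _).trans (by omega)
  have hp0 : p = 0 := Polynomial.eq_zero_of_natDegree_lt_card_of_eval_eq_zero p
    (f := fun j : Fin q => ω ^ (j : ℕ))
    (fun a b hab => Fin.ext (hω.pow_inj a.2 b.2 hab)) hroot hdeg
  ext j
  have hj := congrArg (fun p => Polynomial.coeff p (j : ℕ)) hp0
  simp only [hp, Polynomial.finsetSum_coeff, Polynomial.coeff_monomial, Finset.sum_ite_eq',
    Finset.mem_range, Polynomial.coeff_zero] at hj
  rw [if_pos (by omega), oddExtension_val] at hj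
  exact hj

/-- Linear forms with linearly independent coefficient vectors generate the ideal of the
variables. -/
theorem span_range_sum_C_mul_X {k ι : Type*} [Field k] [Fintype ι] (c : Matrix ι ι k)
    (hc : ∀ y : ι → k, c.mulVec y = 0 → y = 0) :
    Ideal.span (Set.range fun i => ∑ j, C (c i j) * X j) = idealOfVars ι k := by
  classical
  apply le_antisymm
  · rw [Ideal.span_le]
    rintro _ ⟨i, rfl⟩
    exact Ideal.sum_mem _ fun j _ => Ideal.mul_mem_left _ _ (Ideal.subset_span ⟨j, rfl⟩)
  · rw [idealOfVars, Ideal.span_le]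
    rintro _ ⟨j, rfl⟩
    have hinj : Function.Injective c.mulVec := by
      intro x y hxy
      exact sub_eq_zero.1 (hc _ (by rw [Matrix.mulVec_sub, hxy, sub_self]))
    have hunit : c⁻¹ * c = 1 := Matrix.nonsing_inv_mul _
      ((Matrix.isUnit_iff_isUnit_det _).1 (Matrix.mulVec_injective_iff_isUnit.1 hinj))
    have hX : (X j : MvPolynomial ι k) = ∑ i, C (c⁻¹ j i) * ∑ l, C (c i l) * X l := by
      simp_rw [Finset.mul_sum, ← mul_assoc, ← C_mul]
      rw [Finset.sum_comm]
      simp_rw [← Finset.sum_mul, ← map_sum, ← Matrix.mul_apply, hunit]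
      simp [Matrix.one_apply]
    rw [SetLike.mem_coe, hX]
    exact Ideal.sum_mem _ fun i _ => Ideal.mul_mem_left _ _ (Ideal.subset_span ⟨i, rfl⟩)

theorem oddExtension_X_mem_idealOfVars {k : Type*} [Field k] {m : ℕ} (q i : ℕ) :
    oddExtension q (X : Fin m → MvPolynomial (Fin m) k) i ∈ idealOfVars (Fin m) k := by
  unfold oddExtension
  split_ifs
  · exact Ideal.subset_span ⟨_, rfl⟩
  · exact neg_mem (Ideal.subset_span ⟨_, rfl⟩)
  · exact Ideal.zero_mem _

/-- For every period `q ≥ 4` there is a nonzero odd potential with the discriminant of the zero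
potential. -/
theorem exists_odd_isospectral {m e : ℕ} (hm : 2 ≤ m) (he : e ≤ 1) :
    ∃ x : Fin m → ℂ, x ≠ 0 ∧
      (transferMatrix (fun i => Polynomial.X - Polynomial.C (oddExtension (m + e + m) x i))
        (m + e + m)).trace = (transferMatrix (fun _ => Polynomial.X) (m + e + m)).trace := by
  obtain ⟨g, hg, hgT⟩ := exists_generators_of_oddExtension (k := ℂ) (m := m) (by omega) he
  set q := m + e + m with hq
  have hq0 : q ≠ 0 := by omega
  set v := oddExtension q (X : Fin m → MvPolynomial (Fin m) ℂ) with hv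
  -- A root of order 2q gives z^q = ±1, covering periodic and antiperiodic double eigenvalues. The
  -- frequencies z² = ω^(j+1) with 1 ≤ j + 1 ≤ m represent each inverse pair of nontrivial ones
  -- once.
  have hζ := Complex.isPrimitiveRoot_exp (2 * q) (by omega)
  set ζ := Complex.exp (2 * Real.pi * Complex.I / (2 * q : ℕ)) with hζdef
  have hω : IsPrimitiveRoot (ζ ^ 2) q := hζ.pow (by omega) rfl
  have hsum (j : Fin m) : ∑ i ∈ Finset.range q, v i * (C (ζ ^ ((j : ℕ) + 1)) ^ 2) ^ i =
      ∑ l : Fin m, C ((((ζ ^ 2) ^ ((j : ℕ) + 1)) ^ (l : ℕ) -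
        ((ζ ^ 2) ^ ((j : ℕ) + 1)) ^ (m + e + (m - 1 - l)))) * X l := by
    rw [hv, sum_oddExtension_mul _ he]
    refine Finset.sum_congr rfl fun l _ => ?_
    rw [mul_comm, ← C_pow, ← C_pow, ← C_pow, ← C_sub, ← pow_mul ζ, mul_comm _ 2, pow_mul ζ 2]
  set w : Fin m → MvPolynomial (Fin m) ℂ := fun j =>
    ∑ i ∈ Finset.range q, v i * (C (ζ ^ ((j : ℕ) + 1)) ^ 2) ^ i with hwdef
  have hw : Ideal.span (Set.range w) = idealOfVars (Fin m) ℂ := by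
    have hwc : w = fun j => ∑ l, C ((Matrix.of fun j l : Fin m =>
        ((ζ ^ 2) ^ ((j : ℕ) + 1)) ^ (l : ℕ) -
          ((ζ ^ 2) ^ ((j : ℕ) + 1)) ^ (m + e + (m - 1 - l))) j l) * X l := funext hsum
    rw [hwc]
    refine span_range_sum_C_mul_X _ fun y hy => ?_
    refine eq_zero_of_sum_mul_primitiveRoot_pow_eq_zero he hω y fun j => ?_
    rw [sum_oddExtension_mul _ he]
    have := congrFun hy j
    simp only [Matrix.mulVec, dotProduct, Matrix.of_apply, Pi.zero_apply] at this
    rw [← this]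
    exact Finset.sum_congr rfl fun l _ => mul_comm _ _
  have hwg (j : Fin m) : w j ^ 2 ∈ Ideal.span (Set.range g) ⊔ idealOfVars (Fin m) ℂ ^ 3 := by
    rw [hwdef]
    set z := ζ ^ ((j : ℕ) + 1) with hz
    have hz0 : z ≠ 0 := pow_ne_zero _ (hζ.ne_zero (by omega))
    have hzz : (C z : MvPolynomial (Fin m) ℂ) * C z⁻¹ = 1 := by
      rw [← C_mul, mul_inv_cancel₀ hz0, C_1]
    have hzq : z ^ q * z ^ q = 1 := by
      rw [← pow_add, ← two_mul, hz, ← pow_mul, mul_comm, pow_mul, hζ.pow_eq_one, one_pow]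
    refine sq_mem_of_odd (z' := C z⁻¹) (oddExtension_X_mem_idealOfVars q)
      (fun i hi => oddExtension_reflect _ he hi) ?_ hzz ?_ ?_ ?_
    · have := sum_oddExtension_mul (X : Fin m → MvPolynomial (Fin m) ℂ) he (fun _ => 1)
      simpa using this
    · rw [← C_sub]
      refine (isUnit_iff_ne_zero.2 fun h => ?_).map C
      have h1 : z ^ 2 = 1 := by
        have h2 : z * (z - z⁻¹) = 0 := by rw [h, mul_zero]
        rw [mul_sub, mul_inv_cancel₀ hz0] at h2
        linear_combination h2
      rw [hz, ← pow_mul, mul_comm, pow_mul] at h1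
      have := Nat.le_of_dvd (by omega) ((hω.pow_eq_one_iff_dvd _).1 h1)
      have := j.2
      omega
    · rw [← C_pow, ← C_pow, inv_pow, eq_inv_of_mul_eq_one_left hzq, inv_inv,
        ← eq_inv_of_mul_eq_one_left hzq]
    · have h1 := transferMatrix_map (Polynomial.evalRingHom (C z + C z⁻¹))
        (fun i => Polynomial.X - Polynomial.C (v i)) q
      have h2 := transferMatrix_map (Polynomial.evalRingHom (C z + C z⁻¹))
        (fun _ => (Polynomial.X : Polynomial (MvPolynomial (Fin m) ℂ))) q
      simp only [Polynomial.coe_evalRingHom, Polynomial.eval_sub, Polynomial.eval_X,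
        Polynomial.eval_C] at h1 h2
      rw [← h1, ← h2, Matrix.trace_fin_two, Matrix.trace_fin_two]
      simp only [Matrix.map_apply, ← Polynomial.eval_add, ← Polynomial.eval_sub]
      rw [← Matrix.trace_fin_two, ← Matrix.trace_fin_two, Polynomial.eval_eq_sum_range]
      exact Ideal.sum_mem _ fun b _ => Ideal.mul_mem_right _ _ (hgT b)
  obtain ⟨x, hx0, hx⟩ := exists_ne_zero_mem_zeroLocus hm degLex hg hw hwg
  refine ⟨x, hx0, ?_⟩
  have h1 := transferMatrix_map (Polynomial.mapRingHom (aeval x : _ →ₐ[ℂ] ℂ).toRingHom)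
    (fun i => Polynomial.X - Polynomial.C (v i)) q
  have h2 := transferMatrix_map (Polynomial.mapRingHom (aeval x : _ →ₐ[ℂ] ℂ).toRingHom)
    (fun _ => (Polynomial.X : Polynomial (MvPolynomial (Fin m) ℂ))) q
  simp only [map_sub, Polynomial.coe_mapRingHom, Polynomial.map_X, Polynomial.map_C] at h1 h2
  have hvx (i : ℕ) : (aeval x : _ →ₐ[ℂ] ℂ).toRingHom (v i) = oddExtension q x i := by
    rw [hv, map_oddExtension]
    simp
  simp_rw [hvx] at h1
  rw [← h1, ← h2, ← sub_eq_zero]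
  have h3 (A : Matrix (Fin 2) (Fin 2) (Polynomial (MvPolynomial (Fin m) ℂ))) :
      (A.map (Polynomial.map (aeval x : _ →ₐ[ℂ] ℂ).toRingHom)).trace =
        A.trace.map (aeval x : _ →ₐ[ℂ] ℂ).toRingHom := by
    simp [Matrix.trace_fin_two]
  rw [h3, h3, ← Polynomial.map_sub]
  ext b
  rw [Polynomial.coeff_map, Polynomial.coeff_zero]
  exact hx _ (hgT b)

end

/-! ### From odd solutions to periodic potentials -/

theorem theorem4 (q : ℕ) (hq : 4 ≤ q) :
    (∃ v : Fin q → ℂ, v ≠ 0 ∧ v ∈ MvPolynomial.zeroLocus ℂ (spectralInvariantIdeal q)) ∧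
    (∃ V : ℤ → ℂ, Function.Periodic V (q : ℤ) ∧ V ≠ 0 ∧ FloquetIsospectral q V 0) ∧
    (∀ V : ℤ → ℂ, Function.Periodic V (q : ℤ) →
      (FloquetIsospectral q V 0 ↔
        potentialValues q V ∈ MvPolynomial.zeroLocus ℂ (spectralInvariantIdeal q))) := by
  have hiff (V : ℤ → ℂ) : FloquetIsospectral q V 0 ↔
      potentialValues q V ∈ MvPolynomial.zeroLocus ℂ (spectralInvariantIdeal q) := by
    rw [floquetIsospectral_iff, mem_zeroLocus_spectralInvariantIdeal]
    rfl
  obtain ⟨v, hv0, hv⟩ : ∃ v : Fin q → ℂ, v ≠ 0 ∧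
      v ∈ MvPolynomial.zeroLocus ℂ (spectralInvariantIdeal q) := by
    obtain ⟨m, e, hm, he, rfl⟩ : ∃ m e, 2 ≤ m ∧ e ≤ 1 ∧ q = m + e + m :=
      ⟨q / 2, q % 2, by omega, by omega, by omega⟩
    obtain ⟨x, hx0, hx⟩ := exists_odd_isospectral hm he
    refine ⟨fun i => oddExtension (m + e + m) x i, fun h => hx0 ?_, ?_⟩
    · ext j
      have := congrFun h ⟨j, by omega⟩
      simpa [oddExtension_val] using this
    · rw [mem_zeroLocus_spectralInvariantIdeal]
      exact dispersionPolynomial_eq_of_trace_eq (by omega) (oddExtension (m + e + m) x)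
        (fun _ => 0) (by simpa using hx)
  refine ⟨⟨v, hv0, hv⟩, ?_, fun V _ => hiff V⟩
  have hq0 : (0 : ℤ) < q := by omega
  -- The fundamental domain is 1, …, q while `Fin q` starts at 0, hence the shift by one in the
  -- periodic extension.
  have hlt (n : ℤ) : ((n - 1) % q).toNat < q := by
    have h1 := Int.emod_nonneg (n - 1) hq0.ne'
    have h2 := Int.emod_lt_of_pos (n - 1) hq0
    omega
  have hval : potentialValues q (fun n => v ⟨((n - 1) % q).toNat, hlt n⟩) = v := by
    ext i
    rw [potentialValues]
    congr 1
    ext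
    simp only [add_sub_cancel_right]
    rw [Int.emod_eq_of_lt (by omega) (by omega), Int.toNat_natCast]
  refine ⟨fun n => v ⟨((n - 1) % q).toNat, hlt n⟩, fun n => ?_, fun h => hv0 ?_, ?_⟩
  · simp only [add_sub_right_comm, Int.add_emod_right]
  · rw [← hval, h]
    rfl
  · rw [hiff, hval]
    exact hv
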